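/- **Theorem (stable tangent bundle of $P_S$).** Let $k\ge 1$, $\ell\ge 0$ and $m_1,\dots,m_k,n_1,\dots,n_\ell\ge 0$ be integers. Let $S(m_1,\dots,m_k)=S^{m_1}\times\cdots\times S^{m_k}$ with the diagonal antipodal $\mathbb Z_2$-action, let $Y=\mathbb{R}P^{n_1}\times\cdots\times\mathbb{R}P^{n_\ell}$ with the involution $\tau$ induced by the antipodal involution $\mathbf y\mapsto-\mathbf y$ of $S^{n_1}\times\cdots\times S^{n_\ell}$ (so that $\tau$ is in fact the identity of $Y$), and let $$P_S=P_S(m_1,\dots,m_k;n_1,\dots,n_\ell)=\bigl(S(m_1,\dots,m_k)\times Y\bigr)/\bigl((\mathbf x,y)\sim(-\mathbf x,\tau y)\bigr),$$ a smooth manifold with the quotient smooth structure. Let $\varepsilon$ be the trivial real line bundle on $P_S$. Let $\eta$ be the quotient of $S(m_1,\dots,m_k)\times Y\times\mathbb R$ by $(\mathbf x,y,t)\sim(-\mathbf x,\tau y,-t)$, and for $1\le j\le\ell$ let $\zeta'_j$ be the quotient of $S(m_1,\dots,m_k)\times S^{n_1}\times\cdots\times S^{n_\ell}\times\mathbb R$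 by the relations $$(\mathbf x,\mathbf y,t)\sim(-\mathbf x,-\mathbf y,-t),\qquad (\mathbf x,\mathbf y,t)\sim(\mathbf x,h\mathbf y,h_jt)\quad (h=(h_1,\dots,h_\ell)\in\{\pm1\}^\ell),$$ where $h\mathbf y=(h_1\mathbf y_1,\dots,h_\ell\mathbf y_\ell)$. Then $\eta$ and $\zeta'_1,\dots,\zeta'_\ell$ are real line bundles on $P_S$, and there is an isomorphism of real vector bundles over $P_S$ $$T P_S\oplus(k+\ell)\varepsilon\;\cong\;\Bigl(\sum_{i=1}^k(m_i+1)\Bigr)\eta\oplus(n_1+1)\zeta'_1\oplus\cdots\oplus(n_\ell+1)\zeta'_\ell .$$ -/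

import Mathlib

noncomputable section

open scoped Manifold ContDiff Bundle
open Bundle Topology

/-! ### Smooth structures on orbit spaces and on finite products -/

/-- The orbit space of a free, properly discontinuous action by `C^r` diffeomorphisms, with the
charts pushed forward along the orbit map, is a `C^r` manifold. -/
theorem orbitQuotient_isManifold {E H M G : Type*} [NormedAddCommGroup E] [NormedSpace ℝ E]
    [TopologicalSpace H] (I : ModelWithCorners ℝ E H) (r : ℕ∞ω)
    [TopologicalSpace M] [ChartedSpace H M] [IsManifold I r M] [Group G] [MulAction G M]
    [ProperlyDiscontinuousSMul G M] [ContinuousConstSMul G M] [IsCancelSMul G M]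
    [T2Space M] [LocallyCompactSpace M]
    (hG : ∀ g : G, ContMDiff I I r (fun x : M => g • x)) :
    IsManifold I r (MulAction.orbitRel.Quotient G M) := by
  have hq : IsQuotientCoveringMap (Quotient.mk (MulAction.orbitRel G M)) G :=
    isQuotientCoveringMap_quotientMk_of_properlyDiscontinuousSMul
  have hl : IsLocalHomeomorph (Quotient.mk (MulAction.orbitRel G M)) :=
    hq.isCoveringMap.isLocalHomeomorph
  apply isManifold_of_contDiffOn
  rintro _ _ ⟨p, rfl⟩ ⟨p', rfl⟩
  generalize (Quotient.mk_surjective (s := MulAction.orbitRel G M)).hasRightInverse.choose p = a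
  generalize (Quotient.mk_surjective (s := MulAction.orbitRel G M)).hasRightInverse.choose p' = a'
  rintro z ⟨⟨⟨h1, h2⟩, h3, h4⟩, hzr⟩
  set y : M := (extChartAt I a).symm z with hy
  have hymem : (chartAt H a).symm (I.symm z) = y := rfl
  have h2' : y ∈ (hl.localInverseAt a).target := h2
  have h3' : (hl.localInverseAt a).symm y ∈ (hl.localInverseAt a').source := h3
  have h4' : (hl.localInverseAt a') ((hl.localInverseAt a).symm y) ∈ (chartAt H a').source := h4
  rw [hl.localInverseAt_symm] at h3' h4'
  have hzt : z ∈ (extChartAt I a).target := by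
    rw [extChartAt_target]; exact ⟨h1, hzr⟩
  -- near `y` the composite of the projection with a local section is the action of some `g`
  obtain ⟨g, hg⟩ := hq.apply_eq_iff_mem_orbit.1 (hl.apply_localInverseAt_of_mem h3')
  have hg' : g • y = hl.localInverseAt a' (Quotient.mk _ y) := hg
  have hgt : g • y ∈ (hl.localInverseAt a').target := by
    rw [hg']; exact (hl.localInverseAt a').map_source h3'
  have hev : ∀ᶠ w in 𝓝 y, hl.localInverseAt a' (Quotient.mk _ w) = g • w := by
    have e1 : ∀ᶠ w in 𝓝 y, g • w ∈ (hl.localInverseAt a').target :=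
      (continuous_const_smul g).continuousAt.eventually_mem
        ((hl.localInverseAt a').open_target.mem_nhds hgt)
    filter_upwards [e1] with w hw
    have : Quotient.mk (MulAction.orbitRel G M) w = Quotient.mk _ (g • w) := (hq.map_smul g).symm
    rw [this]
    have h := (hl.localInverseAt a').right_inv hw
    rwa [hl.localInverseAt_symm] at h
  have hcont : ContMDiffWithinAt 𝓘(ℝ, E) I r (extChartAt I a).symm (Set.range I) z :=
    contMDiffWithinAt_extChartAt_symm_range a hzt
  have hsrc : g • y ∈ (chartAt H a').source := by rw [hg']; exact h4'
  have hF : ContMDiffWithinAt 𝓘(ℝ, E) 𝓘(ℝ, E) r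
      (fun w => extChartAt I a' (g • (extChartAt I a).symm w)) (Set.range I) z :=
    (contMDiffAt_extChartAt' (x := a') hsrc).comp_contMDiffWithinAt z
      ((hG g).contMDiffAt.comp_contMDiffWithinAt z hcont)
  have hF' := (contMDiffWithinAt_iff_contDiffWithinAt.1 hF).mono
    (Set.inter_subset_right (s := I.symm ⁻¹' (((hl.localInverseAt a).trans (chartAt H a)).symm.trans
      ((hl.localInverseAt a').trans (chartAt H a'))).source))
  refine hF'.congr_of_eventuallyEq ?_ ?_
  · have := (hcont.continuousWithinAt.mono
      (Set.inter_subset_right (s := I.symm ⁻¹' (((hl.localInverseAt a).trans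
        (chartAt H a)).symm.trans ((hl.localInverseAt a').trans
          (chartAt H a'))).source))).eventually hev
    filter_upwards [this] with w hw
    change I (chartAt H a' (hl.localInverseAt a' ((hl.localInverseAt a).symm
      ((extChartAt I a).symm w)))) = I (chartAt H a' (g • (extChartAt I a).symm w))
    rw [hl.localInverseAt_symm, hw]
  · change I (chartAt H a' (hl.localInverseAt a' ((hl.localInverseAt a).symm y))) =
      I (chartAt H a' (g • y))
    rw [hl.localInverseAt_symm, hev.self_of_nhds]


/-- A finite product of `C^r` manifolds is a `C^r` manifold. -/
theorem pi_isManifold {ι : Type*} [Fintype ι] {E H M : ι → Type*} [∀ i, NormedAddCommGroup (E i)]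
    [∀ i, NormedSpace ℝ (E i)] [∀ i, TopologicalSpace (H i)]
    (I : ∀ i, ModelWithCorners ℝ (E i) (H i)) (r : ℕ∞ω) [∀ i, TopologicalSpace (M i)]
    [∀ i, ChartedSpace (H i) (M i)] [∀ i, IsManifold (I i) r (M i)] :
    IsManifold (ModelWithCorners.pi I) r (∀ i, M i) := by
  apply isManifold_of_contDiffOn
  rintro _ _ ⟨e, he, rfl⟩ ⟨e', he', rfl⟩
  rw [contDiffOn_pi]
  intro i
  have h := ((contDiffGroupoid r (I i)).compatible (he i trivial) (he' i trivial)).1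
  have h' : ContDiffOn ℝ r (I i ∘ (e i).symm.trans (e' i) ∘ (I i).symm)
    ((I i).symm ⁻¹' ((e i).symm.trans (e' i)).source ∩ Set.range (I i)) := h
  refine h'.comp (t := (I i).symm ⁻¹' ((e i).symm.trans (e' i)).source ∩ Set.range (I i))
    (f := fun x : ∀ i, E i => x i) (ContinuousLinearMap.proj (R := ℝ) (φ := E) i).contDiff.contDiffOn ?_
  rintro x ⟨⟨hx1, hx2⟩, ⟨w, rfl⟩⟩
  exact ⟨⟨hx1 i trivial, hx2 i trivial⟩, ⟨w i, rfl⟩⟩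

/-- A finite product of `C^r` self-maps is `C^r`. -/
theorem contMDiff_piMap {ι : Type*} [Fintype ι] {E H M : ι → Type*} [∀ i, NormedAddCommGroup (E i)]
    [∀ i, NormedSpace ℝ (E i)] [∀ i, TopologicalSpace (H i)]
    (I : ∀ i, ModelWithCorners ℝ (E i) (H i)) (r : ℕ∞ω) [∀ i, TopologicalSpace (M i)]
    [∀ i, ChartedSpace (H i) (M i)] (f : ∀ i, M i → M i) (hf : ∀ i, ContMDiff (I i) (I i) r (f i)) :
    ContMDiff (ModelWithCorners.pi I) (ModelWithCorners.pi I) r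
      (fun (x : ∀ i, M i) i => f i (x i)) := by
  intro x
  rw [contMDiffAt_iff]
  refine ⟨(continuous_pi fun i => (hf i).continuous.comp (continuous_apply i)).continuousAt, ?_⟩
  rw [contDiffWithinAt_pi]
  intro i
  have h := (contMDiffAt_iff.1 (hf i (x i))).2
  refine ContDiffWithinAt.comp (t := Set.range (I i)) (f := fun x : ∀ i, E i => x i)
    (extChartAt (ModelWithCorners.pi I) x x) h (ContinuousLinearMap.proj (R := ℝ) (φ := E) i).contDiff.contDiffWithinAt ?_
  rintro _ ⟨w, rfl⟩
  exact ⟨w i, rfl⟩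

/-! ### Spheres, real projective spaces and the manifold `P_S` -/

/-- The standard unit sphere `S^d` in `ℝ^(d+1)`. -/
abbrev Sph (d : ℕ) : Type := Metric.sphere (0 : EuclideanSpace ℝ (Fin (d + 1))) 1

/-- The antipodal action of `ℤ₂ = {1, -1}` on the sphere `S^d`. -/
instance antipodalAction (d : ℕ) : MulAction ℤˣ (Sph d) where
  smul g x := ⟨(((g : ℤ) : ℝ)) • (x : EuclideanSpace ℝ (Fin (d + 1))), by
    rcases Int.units_eq_one_or g with rfl | rfl <;> simp⟩
  one_smul x := by ext1; change (((1 : ℤˣ) : ℤ) : ℝ) • _ = _; simp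
  mul_smul g h x := by
    ext1
    change (((g * h : ℤˣ) : ℤ) : ℝ) • _ = ((g : ℤ) : ℝ) • (((h : ℤ) : ℝ) • _)
    rw [smul_smul]; push_cast; rfl

instance (d : ℕ) : SMul ℤˣ (Sph d) := (antipodalAction d).toSMul

theorem Sph.coe_smul {d : ℕ} (g : ℤˣ) (x : Sph d) :
    ((g • x : Sph d) : EuclideanSpace ℝ (Fin (d + 1))) =
      ((g : ℤ) : ℝ) • (x : EuclideanSpace ℝ (Fin (d + 1))) := rfl

theorem Sph.neg_one_smul {d : ℕ} (x : Sph d) : (-1 : ℤˣ) • x = -x := by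
  ext1; rw [Sph.coe_smul]; simp

instance (d : ℕ) : ContinuousConstSMul ℤˣ (Sph d) where
  continuous_const_smul g :=
    Continuous.subtype_mk (f := fun x : Sph d => ((g : ℤ) : ℝ) • x.1)
      (continuous_const_smul (((g : ℤ) : ℝ)) |>.comp continuous_subtype_val) _

theorem Sph.smul_eq_imp {d : ℕ} {g h : ℤˣ} {x : Sph d} (e : g • x = h • x) : g = h := by
  have e' := congrArg (Subtype.val : Sph d → EuclideanSpace ℝ (Fin (d + 1))) e
  rw [Sph.coe_smul, Sph.coe_smul] at e'
  have hx : (x : EuclideanSpace ℝ (Fin (d + 1))) ≠ 0 := ne_zero_of_mem_unit_sphere x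
  exact Units.ext (by exact_mod_cast smul_left_injective ℝ hx e')

instance (d : ℕ) : IsCancelSMul ℤˣ (Sph d) where
  right_cancel' _ _ _ e := Sph.smul_eq_imp e

theorem Sph.contMDiff_smul {d : ℕ} (g : ℤˣ) :
    ContMDiff (𝓡 d) (𝓡 d) ω (fun x : Sph d => g • x) := by
  have := Fact.mk (@finrank_euclideanSpace_fin ℝ _ (d + 1))
  rcases Int.units_eq_one_or g with rfl | rfl
  · simp only [one_smul]; exact contMDiff_id
  · simp only [Sph.neg_one_smul]
    exact contMDiff_neg_sphere

/-- Real projective space `ℝP^d = S^d / (x ∼ -x)`. -/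
abbrev RP (d : ℕ) : Type := MulAction.orbitRel.Quotient ℤˣ (Sph d)

instance (d : ℕ) : IsManifold (𝓡 d) ω (RP d) := orbitQuotient_isManifold _ _ Sph.contMDiff_smul

/-- The quotient map `S^d → ℝP^d`. -/
def RP.mk {d : ℕ} (y : Sph d) : RP d := Quotient.mk _ y

theorem RP.mk_smul {d : ℕ} (g : ℤˣ) (y : Sph d) : RP.mk (g • y) = RP.mk y :=
  Quotient.sound ⟨g, rfl⟩

/-- The involution of `ℝP^d` induced by the antipodal involution of `S^d`: `[y] ↦ [-y]`. -/
instance RP.involution (d : ℕ) : MulAction ℤˣ (RP d) where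
  smul g := Quotient.map (fun y => g • y) (by
    rintro _ y ⟨h, rfl⟩
    exact ⟨h, smul_comm h g y⟩)
  one_smul := by rintro ⟨y⟩; exact congrArg RP.mk (one_smul ℤˣ y)
  mul_smul g h := by rintro ⟨y⟩; exact congrArg RP.mk (mul_smul g h y)

instance (d : ℕ) : SMul ℤˣ (RP d) := (RP.involution d).toSMul

theorem RP.smul_mk {d : ℕ} (g : ℤˣ) (y : Sph d) : g • RP.mk y = RP.mk (g • y) := rfl

theorem RP.smul_eq {d : ℕ} (g : ℤˣ) (y : RP d) : g • y = y := by
  induction y using Quotient.inductionOn with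
  | h y => exact (RP.smul_mk g y).trans (RP.mk_smul g y)

instance (d : ℕ) : ContinuousConstSMul ℤˣ (RP d) where
  continuous_const_smul g := by simp only [RP.smul_eq]; exact continuous_id

/-- `S(m₁, …, m_k) = S^{m₁} × ⋯ × S^{m_k}`; `ℤ₂` acts on it by the diagonal antipodal action. -/
abbrev SphProd {k : ℕ} (m : Fin k → ℕ) : Type := ∀ i, Sph (m i)

/-- `ℝP^{n₁} × ⋯ × ℝP^{n_ℓ}`, with the product of the involutions of the factors. -/
abbrev RPProd {l : ℕ} (n : Fin l → ℕ) : Type := ∀ j, RP (n j)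

section PS

variable {k l : ℕ} (m : Fin k → ℕ) (n : Fin l → ℕ)

/-- The diagonal antipodal action on `S(m₁, …, m_k)`. -/
instance SphProd.action : MulAction ℤˣ (SphProd m) := Pi.mulAction ℤˣ
instance : SMul ℤˣ (SphProd m) := (SphProd.action m).toSMul

/-- The involution of `∏ ℝP^{n_j}`, acting on each factor by `[y] ↦ [-y]`. -/
instance RPProd.action : MulAction ℤˣ (RPProd n) := Pi.mulAction ℤˣ
instance : SMul ℤˣ (RPProd n) := (RPProd.action n).toSMul

/-- The diagonal action `(x, y) ↦ (-x, τ y)` on `S(m₁, …, m_k) × ∏ ℝP^{n_j}`. -/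
instance PSCover.action : MulAction ℤˣ (SphProd m × RPProd n) := Prod.mulAction

instance PSCover.smul : SMul ℤˣ (SphProd m × RPProd n) := (PSCover.action m n).toSMul

theorem PSCover.smul_def (g : ℤˣ) (x : SphProd m) (y : RPProd n) :
    g • (x, y) = ((fun i => g • x i, fun j => g • y j) : SphProd m × RPProd n) := rfl

instance : ContinuousConstSMul ℤˣ (SphProd m × RPProd n) where
  continuous_const_smul g :=
    (continuous_pi fun i => ((continuous_apply i).comp continuous_fst).const_smul g).prodMk
      (continuous_pi fun i => ((continuous_apply i).comp continuous_snd).const_smul g)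

instance [NeZero k] : IsCancelSMul ℤˣ (SphProd m × RPProd n) where
  right_cancel' _ _ x e :=
    Sph.smul_eq_imp (congrFun (congrArg Prod.fst e) (0 : Fin k) : _ • x.1 0 = _ • x.1 0)

/-- The generalized projective product space
`P_S(m₁, …, m_k; n₁, …, n_ℓ) = (S(m₁, …, m_k) × ∏ ℝP^{n_j}) / ℤ₂`. -/
abbrev PS : Type := MulAction.orbitRel.Quotient ℤˣ (SphProd m × RPProd n)

/-- The vector space on which the manifold `P_S` is modelled. -/
abbrev PS.E : Type :=
  (∀ i, EuclideanSpace ℝ (Fin (m i))) × (∀ j, EuclideanSpace ℝ (Fin (n j)))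

/-- The vector space `PS.E`, as the model space of a product of manifolds. -/
abbrev PS.H : Type :=
  ModelProd (ModelPi fun i => EuclideanSpace ℝ (Fin (m i)))
    (ModelPi fun j => EuclideanSpace ℝ (Fin (n j)))

/-- The (boundaryless) model with corners of `P_S`. -/
abbrev PS.model : ModelWithCorners ℝ (PS.E m n) (PS.H m n) :=
  (ModelWithCorners.pi fun i => 𝓡 (m i)).prod (ModelWithCorners.pi fun j => 𝓡 (n j))

/-- The charts of `P_S` are those of `S(m) × ∏ ℝP^{n_j}`, pushed forward along the orbit map. -/
instance [NeZero k] : ChartedSpace (PS.H m n) (PS m n) :=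
  MulAction.instChartedSpaceQuotient (M := SphProd m × RPProd n)

instance [NeZero k] : IsManifold (PS.model m n) ω (PS m n) := by
  have := pi_isManifold (M := fun i => Sph (m i)) (fun i => 𝓡 (m i)) ω
  have := pi_isManifold (M := fun i => RP (n i)) (fun i => 𝓡 (n i)) ω
  refine orbitQuotient_isManifold _ _ fun g => ?_
  refine ContMDiff.prodMap (f := fun x : SphProd m => g • x) (g := fun y : RPProd n => g • y) ?_ ?_
  · exact contMDiff_piMap _ _ (fun i (x : Sph (m i)) => g • x) fun i => Sph.contMDiff_smul g
  · refine contMDiff_piMap _ _ (fun i (x : RP (n i)) => g • x) fun i => ?_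
    simp only [RP.smul_eq]; exact contMDiff_id


/-- The action of `ℤ₂ × ℤ₂^ℓ` on `S(m) × ∏ S^{n_j}` in which the generator of `ℤ₂` acts by
`(x, y) ↦ (-x, -y)` and `δ ∈ ℤ₂^ℓ` acts by `(x, y) ↦ (x, (δ_j y_j)_j)`. -/
instance SmallCover.action : MulAction (ℤˣ × (Fin l → ℤˣ)) (SphProd m × SphProd n) where
  smul g p := (g.1 • p.1, fun j => (g.1 * g.2 j) • p.2 j)
  one_smul p := by
    refine Prod.ext (one_smul ℤˣ p.1) (funext fun j => ?_)
    change ((1 : ℤˣ) * 1) • p.2 j = p.2 j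
    rw [one_mul, one_smul]
  mul_smul g h p := by
    refine Prod.ext (mul_smul g.1 h.1 p.1) (funext fun j => ?_)
    change (g.1 * h.1 * (g.2 j * h.2 j)) • p.2 j = (g.1 * g.2 j) • (h.1 * h.2 j) • p.2 j
    rw [smul_smul, mul_mul_mul_comm]

instance : SMul (ℤˣ × (Fin l → ℤˣ)) (SphProd m × SphProd n) := (SmallCover.action m n).toSMul

theorem SmallCover.smul_def (g : ℤˣ × (Fin l → ℤˣ)) (x : SphProd m) (y : SphProd n) :
    g • (x, y) = (g.1 • x, fun j => (g.1 * g.2 j) • y j) := rfl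

instance : ContinuousConstSMul (ℤˣ × (Fin l → ℤˣ)) (SphProd m × SphProd n) where
  continuous_const_smul g :=
    (continuous_pi fun i => ((continuous_apply i).comp continuous_fst).const_smul g.1).prodMk
      (continuous_pi fun j => ((continuous_apply j).comp continuous_snd).const_smul (g.1 * g.2 j))

instance [NeZero k] : IsCancelSMul (ℤˣ × (Fin l → ℤˣ)) (SphProd m × SphProd n) where
  right_cancel' g h p e := by
    have e1 : g.1 = h.1 :=
      Sph.smul_eq_imp (congrFun (congrArg Prod.fst e) (0 : Fin k) : g.1 • p.1 0 = h.1 • p.1 0)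
    refine Prod.ext e1 (funext fun j => ?_)
    have e2 : g.1 * g.2 j = h.1 * h.2 j :=
      Sph.smul_eq_imp (congrFun (congrArg Prod.snd e) j : _ • p.2 j = _ • p.2 j)
    rw [e1] at e2
    exact mul_left_cancel e2

/-- The orbit map `S(m) × ∏ ℝP^{n_j} → P_S(m; n)`. -/
def PS.mk (p : SphProd m × RPProd n) : PS m n := Quotient.mk _ p

theorem PS.isQuotientCoveringMap_mk [NeZero k] : IsQuotientCoveringMap (PS.mk m n) ℤˣ :=
  isQuotientCoveringMap_quotientMk_of_properlyDiscontinuousSMul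

/-- The composite `S(m) × ∏ S^{n_j} → S(m) × ∏ ℝP^{n_j} → P_S(m; n)`. -/
def PS.mk' (p : SphProd m × SphProd n) : PS m n := PS.mk m n (p.1, fun j => RP.mk (p.2 j))

/-- `P_S` is also the orbit space of `S(m) × ∏ S^{n_j}` under `ℤ₂ × ℤ₂^ℓ`. -/
theorem PS.isQuotientCoveringMap_mk' [NeZero k] :
    IsQuotientCoveringMap (PS.mk' m n) (ℤˣ × (Fin l → ℤˣ)) := by
  have h1 (d : ℕ) : IsOpenQuotientMap (RP.mk (d := d)) :=
    (isQuotientCoveringMap_quotientMk_of_properlyDiscontinuousSMul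
      (E := Sph d) (G := ℤˣ)).isOpenQuotientMap
  have h2 : IsOpenQuotientMap (PS.mk' m n) :=
    (PS.isQuotientCoveringMap_mk m n).isOpenQuotientMap.comp
      (IsOpenQuotientMap.id.prodMap (IsOpenQuotientMap.piMap fun j => h1 (n j)))
  refine h2.isQuotientMap.isQuotientCoveringMap_of_properlyDiscontinuousSMul ?_
  rintro ⟨x, y⟩ ⟨x', y'⟩
  constructor
  · intro h
    obtain ⟨g, hg⟩ := (PS.isQuotientCoveringMap_mk m n).apply_eq_iff_mem_orbit.1 h
    have hy (j : Fin l) : ∃ d : ℤˣ, d • g • y' j = y j :=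
      Quotient.exact (congrFun (congrArg Prod.snd hg) j : RP.mk (g • y' j) = RP.mk (y j)).symm
    choose d hd using hy
    refine ⟨(g, d), Prod.ext (congrArg Prod.fst hg :) (funext fun j => ?_)⟩
    change (g * d j) • y' j = y j
    rw [← hd j, smul_smul, mul_comm]
  · rintro ⟨g, hg⟩
    refine (PS.isQuotientCoveringMap_mk m n).apply_eq_iff_mem_orbit.2
      ⟨g.1, Prod.ext (congrArg Prod.fst hg :) (funext fun j => ?_)⟩
    have : (g.1 * g.2 j) • y' j = y j := congrFun (congrArg Prod.snd hg) j
    change g.1 • RP.mk (y' j) = RP.mk (y j)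
    rw [← this, RP.smul_eq, RP.mk_smul]

end PS

/-! ### Families of real vector spaces, vector bundles and Whitney sums -/

/-- A family of real vector spaces over `B`: a real vector space `Fib b` for every `b : B`, together
with a topology on the total space, the disjoint union of the `Fib b`. (`F` is the nominal model fibre, which Mathlib's
type of total spaces carries along; it plays no other role.) -/
structure VectorFamily (B : Type) where
  F : Type
  Fib : B → Type
  addCommGroup : ∀ b, AddCommGroup (Fib b)
  module : ∀ b, Module ℝ (Fib b)
  topology : TopologicalSpace (TotalSpace F Fib)

namespace VectorFamily

attribute [instance] VectorFamily.addCommGroup VectorFamily.module VectorFamily.topology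

variable {B : Type} [TopologicalSpace B]

/-- A line bundle is a family of real vector spaces which, near every point of the base, admits a
fibrewise linear local trivialization with fibre `ℝ`. -/
def IsLineBundle (V : VectorFamily B) : Prop :=
  ∀ b : B, ∃ e : Trivialization ℝ (TotalSpace.proj : TotalSpace V.F V.Fib → B),
    b ∈ e.baseSet ∧ ∀ c ∈ e.baseSet, IsLinearMap ℝ (fun v : V.Fib c => (e ⟨c, v⟩).2)

/-- `V` and `W` are isomorphic: there is a homeomorphism of total spaces which covers the identity
of the base and restricts to linear isomorphisms of the fibres. -/
def Isomorphic (V W : VectorFamily B) : Prop :=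
  ∃ φ : ∀ b, V.Fib b ≃ₗ[ℝ] W.Fib b,
    Continuous (fun p : TotalSpace V.F V.Fib => (⟨p.1, φ p.1 p.2⟩ : TotalSpace W.F W.Fib)) ∧
    Continuous (fun p : TotalSpace W.F W.Fib => (⟨p.1, (φ p.1).symm p.2⟩ : TotalSpace V.F V.Fib))

variable (B) in
/-- The trivial bundle `Nε = B × ℝ^N`. -/
def trivial (N : ℕ) : VectorFamily B where
  F := Fin N → ℝ
  Fib := Bundle.Trivial B (Fin N → ℝ)
  addCommGroup := fun _ => inferInstanceAs (AddCommGroup (Fin N → ℝ))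
  module := fun _ => inferInstanceAs (Module ℝ (Fin N → ℝ))
  topology := inferInstance

/-- The Whitney sum `V ⊕ W`. -/
def sum (V W : VectorFamily B) : VectorFamily B where
  F := V.F × W.F
  Fib := V.Fib ×ᵇ W.Fib
  addCommGroup := fun b => inferInstanceAs (AddCommGroup (V.Fib b × W.Fib b))
  module := fun b => inferInstanceAs (Module ℝ (V.Fib b × W.Fib b))
  topology := FiberBundle.Prod.topologicalSpace V.F V.Fib W.F W.Fib

/-- The Whitney sum `⨁ i, V i` of a family; its total space is the fibre product over `B` of the
total spaces of the `V i`, with the topology induced from `B × ∏ i, (V i).TotalSpace`. -/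
def iSum {ι : Type} (V : ι → VectorFamily B) : VectorFamily B where
  F := ∀ i, (V i).F
  Fib := fun b => ∀ i, (V i).Fib b
  addCommGroup := fun _ => Pi.addCommGroup
  module := fun _ => Pi.module _ _ _
  topology := TopologicalSpace.induced
    (fun p => (p.1, fun i => (⟨p.1, p.2 i⟩ : TotalSpace (V i).F (V i).Fib))) inferInstance

/-- The `N`-fold Whitney sum `N V = V ⊕ ⋯ ⊕ V`. -/
def copies (N : ℕ) (V : VectorFamily B) : VectorFamily B := iSum fun _ : Fin N => V

end VectorFamily

/-! ### Line bundles associated with characters -/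

section Line

variable {X B G : Type} [TopologicalSpace X] [TopologicalSpace B] [Group G] [MulAction G X]
  {q : X → B} (hq : IsQuotientCoveringMap q G) (χ : G →* ℤˣ)

/-- The inclusion of `{1, -1}` in `ℝ`. -/
def sgn : ℤˣ →* ℝ := (Int.castRingHom ℝ : ℤ →* ℝ).comp (Units.coeHom ℤ)

theorem sgn_apply (u : ℤˣ) : sgn u = ((u : ℤ) : ℝ) := rfl

/-- The relation `(x, t) ∼ (g x, χ(g) t)` on the part of `X × ℝ` lying over `b`. -/
def LineFib.setoid (q : X → B) (χ : G →* ℤˣ) (b : B) : Setoid {p : X × ℝ // q p.1 = b} where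
  r p p' := ∃ g : G, p'.1 = (g • p.1.1, sgn (χ g) * p.1.2)
  iseqv :=
    { refl := fun p => ⟨1, by simp⟩
      symm := by
        have key (u : ℤˣ) (t : ℝ) : sgn u⁻¹ * (sgn u * t) = t := by
          rw [← mul_assoc, ← map_mul, inv_mul_cancel, map_one, one_mul]
        rintro ⟨⟨x, t⟩, hp⟩ ⟨⟨x', t'⟩, hp'⟩ ⟨g, hg⟩
        obtain ⟨rfl, rfl⟩ := Prod.ext_iff.1 hg
        refine ⟨g⁻¹, ?_⟩
        refine Prod.ext (inv_smul_smul g x).symm ?_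
        simpa only [map_inv] using (key (χ g) t).symm
      trans := by
        rintro ⟨⟨x, t⟩, hp⟩ ⟨⟨x', t'⟩, hp'⟩ ⟨⟨x'', t''⟩, hp''⟩ ⟨g, hg⟩ ⟨g', hg'⟩
        obtain ⟨rfl, rfl⟩ := Prod.ext_iff.1 hg
        obtain ⟨rfl, rfl⟩ := Prod.ext_iff.1 hg'
        exact ⟨g' * g, by simp [mul_smul, mul_assoc]⟩ }

/-- The fibre over `b` of `(X × ℝ) / G → X / G = B`, where `g (x, t) = (g x, χ(g) t)`. -/
def LineFib (_ : IsQuotientCoveringMap q G) (χ : G →* ℤˣ) (b : B) : Type :=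
  Quotient (LineFib.setoid q χ b)

namespace LineFib

variable {hq χ}

/-- The class `[x, t]`. -/
def mk {b : B} (x : X) (hx : q x = b) (t : ℝ) : LineFib hq χ b :=
  Quotient.mk _ ⟨(x, t), hx⟩

theorem mk_smul {b : B} {x : X} (hx : q x = b) (g : G) (hgx : q (g • x) = b) (t : ℝ) :
    (mk (g • x) hgx (sgn (χ g) * t) : LineFib hq χ b) = mk x hx t :=
  (Quotient.sound ⟨g, rfl⟩ : (mk x hx t : LineFib hq χ b) = _).symm

theorem mk_bijective {b : B} {x : X} (hx : q x = b) :
    Function.Bijective (mk x hx : ℝ → LineFib hq χ b) := by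
  constructor
  · intro t t' h
    obtain ⟨g, hg⟩ := Quotient.exact h
    obtain ⟨h1, h2⟩ := Prod.ext_iff.1 hg
    have : g = 1 := hq.isCancelSMul.right_cancel _ _ x (by simpa using h1.symm)
    subst this
    simpa using h2.symm
  · intro v
    induction v using Quotient.inductionOn with
    | h p =>
      obtain ⟨⟨x', t⟩, hp⟩ := p
      obtain ⟨g, hg⟩ := hq.apply_eq_iff_mem_orbit.1 (hx.trans hp.symm)
      have hg' : g • x' = x := hg
      subst hg'
      exact ⟨sgn (χ g) * t, mk_smul hp g hx t⟩

variable (hq χ)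

/-- The coordinate `[x, t] ↦ t` for some choice of a point `x` over `b`. It transports the vector
space structure of `ℝ` to the fibre; see `LineFib.mk_linear` for independence of the choice. -/
def coord (b : B) : LineFib hq χ b ≃ ℝ :=
  (Equiv.ofBijective _ (mk_bijective (hq.surjective b).choose_spec)).symm

instance (b : B) : AddCommGroup (LineFib hq χ b) := (coord hq χ b).addCommGroup

instance (b : B) : Module ℝ (LineFib hq χ b) := (coord hq χ b).module ℝ

variable {hq χ}

/-- For every point `x` over `b`, the bijection `t ↦ [x, t]` is linear. -/
theorem mk_linear {b : B} {x : X} (hx : q x = b) (c t t' : ℝ) :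
    (mk x hx (c * t + t') : LineFib hq χ b) = c • mk x hx t + mk x hx t' := by
  obtain ⟨g, hg⟩ := hq.apply_eq_iff_mem_orbit.1 ((hq.surjective b).choose_spec.trans hx.symm)
  have hg' : g • x = (hq.surjective b).choose := hg
  have key (s : ℝ) : coord hq χ b (mk x hx s) = sgn (χ g) * s := by
    refine (Equiv.symm_apply_eq _).2 ?_
    have hgx : q (g • x) = b := (hq.map_smul g).trans hx
    rw [← mk_smul hx g hgx]
    simp only [hg', Equiv.ofBijective_apply]
  apply (coord hq χ b).injective
  rw [Equiv.add_def, Equiv.smul_def]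
  simp only [Equiv.apply_symm_apply, key, smul_eq_mul]
  ring

end LineFib

/-- The line bundle `(X × ℝ) / G → X / G = B`, where `G` acts by
`g • (x, t) = (g • x, χ(g) t)`. Its total space carries the quotient topology. -/
def VectorFamily.line : VectorFamily B where
  F := ℝ
  Fib := LineFib hq χ
  addCommGroup := inferInstance
  module := inferInstance
  topology := TopologicalSpace.coinduced
    (fun p : X × ℝ => (⟨q p.1, LineFib.mk p.1 rfl p.2⟩ : TotalSpace ℝ (LineFib hq χ)))
    inferInstance
end Line

/-! ### The bundles on `P_S` -/

section Bundles

variable {k l : ℕ} [NeZero k] (m : Fin k → ℕ) (n : Fin l → ℕ)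

/-- The tangent bundle of the smooth manifold `P_S(m; n)`. -/
def PS.tangent : VectorFamily (PS m n) where
  F := PS.E m n
  Fib := TangentSpace (PS.model m n)
  addCommGroup := inferInstance
  module := inferInstance
  topology := inferInstanceAs (TopologicalSpace (TangentBundle (PS.model m n) (PS m n)))

/-- The line bundle `η = (S(m) × ∏ ℝP^{n_j} × ℝ) / ((x, y, t) ∼ (-x, τ y, -t))`, where `τ` is the
involution of `∏ ℝP^{n_j}`. -/
def PS.eta : VectorFamily (PS m n) :=
  VectorFamily.line (PS.isQuotientCoveringMap_mk m n) (MonoidHom.id ℤˣ)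

/-- The character `(ε, δ) ↦ ε δ_j` of `ℤ₂ × ℤ₂^ℓ`. -/
def PS.zetaChar {l : ℕ} (j : Fin l) : ℤˣ × (Fin l → ℤˣ) →* ℤˣ where
  toFun g := g.1 * g.2 j
  map_one' := mul_one 1
  map_mul' g h := mul_mul_mul_comm g.1 h.1 (g.2 j) (h.2 j)

/-- The line bundle `ζ'_j`: the quotient of `S(m) × ∏ S^{n_i} × ℝ` by
`(x, y, t) ∼ (-x, -y, -t)` and `(x, y, t) ∼ (x, δ y, δ_j t)` for `δ ∈ ℤ₂^ℓ`, where `δ` acts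
on `∏ S^{n_i}` coordinatewise by antipodal maps. -/
def PS.zeta (j : Fin l) : VectorFamily (PS m n) :=
  VectorFamily.line (PS.isQuotientCoveringMap_mk' m n) (PS.zetaChar j)

end Bundles

end

noncomputable section

open scoped Manifold ContDiff Bundle
open Bundle Topology

/-! ### Frames of families of vector spaces -/

/-! Let `X` be the product of all the spheres $S^{m_i}$ and $S^{n_j}$. The orbit map `PS.mk'` from
`X` to $P_S$ is a covering with group $\mathbb Z_2\times\mathbb Z_2^\ell$. Along it both sides of
the isomorphism become trivial with the same fibre, the Euclidean space `PS.Ambient` containing `X`,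
and the group acts on that fibre in both cases by the same signs `PS.ambientAct`. Two families given
by the same descent data are isomorphic (`VectorFamily.Frame.Equivariant.isomorphic`).

For the tangent side, a vector at a point of `X` splits into a tangent vector of the product of
spheres and one radial component per sphere. The derivative of `PS.retr` carries the tangent part to
$TP_S$. The radial components are inner products with the position vectors; these are unchanged when
position and vector change sign together (`PS.radial_smul`), so they give $(k+\ell)\varepsilon$
without a twist.

For the line bundle side, each coordinate of the Euclidean space is multiplied by a character of the
group: $\varepsilon$ in the factors of the $S^{m_i}$, and $\varepsilon\delta_j$ in the factor of
$S^{n_j}$. These are the characters defining $\eta$ (after pullback) and $\zeta'_j$, whence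
$\sum(m_i+1)$ copies of the former and $n_j+1$ of the latter.

The analytic point is that the fibrewise inverse on the tangent side is continuous. It follows from
`PS.eventually_dSec_dRetr`, which inverts by one explicit formula near a given point. -/

theorem VectorFamily.continuous_sumSplit {B : Type} [TopologicalSpace B] (A A' : VectorFamily B) :
    Continuous (fun p : TotalSpace (A.sum A').F (A.sum A').Fib =>
      ((⟨p.1, p.2.1⟩ : TotalSpace A.F A.Fib), (⟨p.1, p.2.2⟩ : TotalSpace A'.F A'.Fib))) :=
  continuous_induced_dom

theorem VectorFamily.continuous_iSumSplit {B : Type} [TopologicalSpace B] {ι : Type}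
    (A : ι → VectorFamily B) :
    Continuous (fun p : TotalSpace (VectorFamily.iSum A).F (VectorFamily.iSum A).Fib =>
      (p.1, fun i => (⟨p.1, p.2 i⟩ : TotalSpace (A i).F (A i).Fib))) :=
  continuous_induced_dom

/-- A trivialization, with fibre `W`, of the pullback of the family `A` along `q : X → B`. -/
structure VectorFamily.Frame {B X : Type} [TopologicalSpace B] [TopologicalSpace X]
    (A : VectorFamily B) (q : X → B) (W : Type) [AddCommGroup W] [Module ℝ W]
    [TopologicalSpace W] where
  -- A `VectorFamily` does not relate the topology of its total space to that of the base, so this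
  -- has to be required.
  continuous_proj : Continuous (TotalSpace.proj : TotalSpace A.F A.Fib → B)
  -- With the proof of `q x = b` as an argument, frames at different points over `b` can be compared
  -- in one fibre, without transport.
  toEquiv : ∀ {b : B} (x : X), q x = b → W ≃ₗ[ℝ] A.Fib b
  continuous_toEquiv : Continuous
    (fun p : X × W => (⟨q p.1, toEquiv p.1 rfl p.2⟩ : TotalSpace A.F A.Fib))
  continuous_symm : Continuous
    (fun p : {p : X × TotalSpace A.F A.Fib // q p.1 = p.2.proj} =>
      (toEquiv p.1.1 p.2).symm p.1.2.2)

namespace VectorFamily.Frame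

variable {B X : Type} [TopologicalSpace B] [TopologicalSpace X] {q : X → B}
  {W : Type} [AddCommGroup W] [Module ℝ W] [TopologicalSpace W]
  {W' : Type} [AddCommGroup W'] [Module ℝ W'] [TopologicalSpace W']
  {A A' : VectorFamily B}

/-- The frame over `q ∘ p` induced by a frame over `q`. -/
def pullback {X' : Type} [TopologicalSpace X'] (Φ : A.Frame q W) (p : X' → X)
    (hp : Continuous p) : A.Frame (fun x => q (p x)) W where
  continuous_proj := Φ.continuous_proj
  toEquiv x hx := Φ.toEquiv (p x) hx
  continuous_toEquiv := Φ.continuous_toEquiv.comp (hp.prodMap continuous_id)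
  continuous_symm := Φ.continuous_symm.comp
    (f := fun y : {y : X' × TotalSpace A.F A.Fib // q (p y.1) = y.2.proj} =>
      (⟨(p y.1.1, y.1.2), y.2⟩ : {y : X × TotalSpace A.F A.Fib // q y.1 = y.2.proj}))
    (by fun_prop)

/-- Change of the fibre of a frame. -/
def congr (Φ : A.Frame q W) (e : W' ≃L[ℝ] W) : A.Frame q W' where
  continuous_proj := Φ.continuous_proj
  toEquiv x hx := e.toLinearEquiv.trans (Φ.toEquiv x hx)
  continuous_toEquiv := Φ.continuous_toEquiv.comp (continuous_id.prodMap e.continuous)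
  continuous_symm := e.symm.continuous.comp Φ.continuous_symm

/-- The Whitney sum of two frames. -/
def sum (Φ : A.Frame q W) (Φ' : A'.Frame q W') : (A.sum A').Frame q (W × W') where
  continuous_proj := Φ.continuous_proj.comp
    (continuous_fst.comp (VectorFamily.continuous_sumSplit A A'))
  toEquiv x hx := LinearEquiv.prodCongr (Φ.toEquiv x hx) (Φ'.toEquiv x hx)
  continuous_toEquiv := continuous_induced_rng.2
    ((Φ.continuous_toEquiv.comp (continuous_id.prodMap continuous_fst)).prodMk
      (Φ'.continuous_toEquiv.comp (continuous_id.prodMap continuous_snd)))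
  continuous_symm := by
    have h := VectorFamily.continuous_sumSplit A A'
    refine Continuous.prodMk
      (Φ.continuous_symm.comp
        (f := fun p : {p : X × TotalSpace (A.sum A').F (A.sum A').Fib // q p.1 = p.2.proj} =>
          (⟨(p.1.1, ⟨p.1.2.1, p.1.2.2.1⟩), p.2⟩ :
            {p : X × TotalSpace A.F A.Fib // q p.1 = p.2.proj})) ?_)
      (Φ'.continuous_symm.comp
        (f := fun p : {p : X × TotalSpace (A.sum A').F (A.sum A').Fib // q p.1 = p.2.proj} =>
          (⟨(p.1.1, ⟨p.1.2.1, p.1.2.2.2⟩), p.2⟩ :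
            {p : X × TotalSpace A'.F A'.Fib // q p.1 = p.2.proj})) ?_)
    · exact Continuous.subtype_mk ((continuous_fst.comp continuous_subtype_val).prodMk
        (continuous_fst.comp (h.comp (continuous_snd.comp continuous_subtype_val)))) _
    · exact Continuous.subtype_mk ((continuous_fst.comp continuous_subtype_val).prodMk
        (continuous_snd.comp (h.comp (continuous_snd.comp continuous_subtype_val)))) _

/-- The Whitney sum of a family of frames. -/
def iSum {ι : Type} {A : ι → VectorFamily B} {W : ι → Type} [∀ i, AddCommGroup (W i)]
    [∀ i, Module ℝ (W i)] [∀ i, TopologicalSpace (W i)] (Φ : ∀ i, (A i).Frame q (W i))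
    (hq : Continuous q) : (VectorFamily.iSum A).Frame q (∀ i, W i) where
  continuous_proj := continuous_fst.comp (VectorFamily.continuous_iSumSplit A)
  toEquiv x hx := LinearEquiv.piCongrRight fun i => (Φ i).toEquiv x hx
  continuous_toEquiv := continuous_induced_rng.2
    ((hq.comp continuous_fst).prodMk (continuous_pi fun i =>
      (Φ i).continuous_toEquiv.comp (continuous_id.prodMap (continuous_apply i))))
  continuous_symm := by
    have h := VectorFamily.continuous_iSumSplit A
    refine continuous_pi fun i => (Φ i).continuous_symm.comp
      (f := fun p : {p : X × TotalSpace (VectorFamily.iSum A).F (VectorFamily.iSum A).Fib //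
          q p.1 = p.2.proj} => (⟨(p.1.1, ⟨p.1.2.1, p.1.2.2 i⟩), p.2⟩ :
            {p : X × TotalSpace (A i).F (A i).Fib // q p.1 = p.2.proj})) ?_
    exact Continuous.subtype_mk ((continuous_fst.comp continuous_subtype_val).prodMk
      ((continuous_apply i).comp
        (continuous_snd.comp (h.comp (continuous_snd.comp continuous_subtype_val))))) _

/-- The `N`-fold Whitney sum of a frame. -/
def copies (N : ℕ) (Φ : A.Frame q W) (hq : Continuous q) :
    (VectorFamily.copies N A).Frame q (Fin N → W) :=
  iSum (fun _ => Φ) hq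

/-- Continuity on the total space can be checked after pulling back along an open quotient map. -/
theorem continuous_of_comp_pullback {T Z : Type} [TopologicalSpace T] [TopologicalSpace Z]
    {pr : T → B} (hpr : Continuous pr) (hq : IsOpenQuotientMap q) {f : T → Z}
    (hf : Continuous (fun p : {p : X × T // q p.1 = pr p.2} => f p.1.2)) : Continuous f := by
  -- The base change of an open quotient map is again a quotient map; for general quotient maps this
  -- fails.
  have h := (hq.prodMap (IsOpenQuotientMap.id (X := T))).restrictPreimage
    {p : B × T | p.1 = pr p.2}
  have h' : Continuous (fun p : {p : B × T | p.1 = pr p.2} => f p.1.2) := by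
    rw [← h.continuous_comp_iff]
    exact hf
  exact h'.comp (f := fun a : T => (⟨(pr a, a), rfl⟩ : {p : B × T | p.1 = pr p.2}))
    (Continuous.subtype_mk (hpr.prodMk continuous_id) _)

variable {G : Type} [Group G] [MulAction G X]

/-- Compatibility of a frame with an action of `G` on `X` and on the fibre. -/
def Equivariant (Φ : A.Frame q W) (ρ : G → W → W) : Prop :=
  ∀ (g : G) (x : X) (h : q x = q (g • x)) (w : W), Φ.toEquiv (g • x) rfl (ρ g w) = Φ.toEquiv x h w

/-- Replacing `x` by `g • x` precomposes both frames with the same `ρ g`, which cancels. Hence the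
comparison of the two fibres depends only on `b`. -/
theorem Equivariant.toEquiv_trans_eq {Φ : A.Frame q W} {Φ' : A'.Frame q W} {ρ : G → W → W}
    (hΦ : Φ.Equivariant ρ) (hΦ' : Φ'.Equivariant ρ) (hq : IsQuotientCoveringMap q G) {b : B}
    {x x' : X} (hx : q x = b) (hx' : q x' = b) :
    (Φ.toEquiv x hx).symm.trans (Φ'.toEquiv x hx) =
      (Φ.toEquiv x' hx').symm.trans (Φ'.toEquiv x' hx') := by
  obtain ⟨g, hg⟩ := hq.apply_eq_iff_mem_orbit.1 (hx'.trans hx.symm)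
  have hg' : g • x = x' := hg
  subst hg'
  subst hx'
  ext a
  obtain ⟨w, rfl⟩ := (Φ.toEquiv x hx).surjective a
  simp only [LinearEquiv.trans_apply, LinearEquiv.symm_apply_apply]
  rw [← hΦ g x hx w, LinearEquiv.symm_apply_apply, hΦ' g x hx w]

/-- Two families which have frames over a quotient covering that transform in the same way under
the group are isomorphic. -/
theorem Equivariant.isomorphic {Φ : A.Frame q W} {Φ' : A'.Frame q W} {ρ : G → W → W}
    (hΦ : Φ.Equivariant ρ) (hΦ' : Φ'.Equivariant ρ) (hq : IsQuotientCoveringMap q G) :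
    A.Isomorphic A' := by
  -- The section `s` need not be continuous: after pullback to `X`, `toEquiv_trans_eq` lets the
  -- point `x` itself take the place of `s (q x)`.
  choose s hs using hq.surjective
  refine ⟨fun b => (Φ.toEquiv (s b) (hs b)).symm.trans (Φ'.toEquiv (s b) (hs b)), ?_, ?_⟩
  · refine continuous_of_comp_pullback Φ.continuous_proj hq.isOpenQuotientMap ?_
    have h := Φ'.continuous_toEquiv.comp
      ((continuous_fst.comp continuous_subtype_val).prodMk Φ.continuous_symm)
    convert h using 1
    funext ⟨⟨x, ⟨b, a⟩⟩, hx⟩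
    change q x = b at hx
    subst hx
    exact congrArg (fun e : A.Fib (q x) ≃ₗ[ℝ] A'.Fib (q x) =>
      (⟨q x, e a⟩ : TotalSpace A'.F A'.Fib)) (hΦ.toEquiv_trans_eq hΦ' hq (hs (q x)) rfl)
  · refine continuous_of_comp_pullback Φ'.continuous_proj hq.isOpenQuotientMap ?_
    have h := Φ.continuous_toEquiv.comp
      ((continuous_fst.comp continuous_subtype_val).prodMk Φ'.continuous_symm)
    convert h using 1
    funext ⟨⟨x, ⟨b, a⟩⟩, hx⟩
    change q x = b at hx
    subst hx
    exact congrArg (fun e : A.Fib (q x) ≃ₗ[ℝ] A'.Fib (q x) =>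
      (⟨q x, e.symm a⟩ : TotalSpace A.F A.Fib)) (hΦ.toEquiv_trans_eq hΦ' hq (hs (q x)) rfl)

/-- A family with a frame with fibre `ℝ` over a surjective local homeomorphism is a line bundle. -/
theorem isLineBundle (Φ : A.Frame q ℝ) (hq : IsLocalHomeomorph q)
    (hs : Function.Surjective q) : A.IsLineBundle := by
  classical
  intro b₀
  obtain ⟨x₀, rfl⟩ := hs b₀
  set σ := hq.localInverseAt x₀
  have hqσ {b : B} (hb : b ∈ σ.source) : q (σ b) = b := hq.apply_localInverseAt_of_mem hb
  have hcs : Continuous (fun b : σ.source => σ b) :=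
    continuousOn_iff_continuous_domRestrict.1 σ.continuousOn
  let pr : TotalSpace A.F A.Fib → B := TotalSpace.proj
  let c : TotalSpace A.F A.Fib → ℝ := fun a =>
    if h : a.1 ∈ σ.source then (Φ.toEquiv (σ a.1) (hqσ h)).symm a.2 else 0
  -- The default off the domain of the local section still lies over `p.1`, so that `hsp` holds
  -- everywhere.
  let s : B × ℝ → TotalSpace A.F A.Fib := fun p =>
    if h : p.1 ∈ σ.source then ⟨p.1, Φ.toEquiv (σ p.1) (hqσ h) p.2⟩ else ⟨p.1, 0⟩
  have hc {a : TotalSpace A.F A.Fib} (h : a.1 ∈ σ.source) :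
      c a = (Φ.toEquiv (σ a.1) (hqσ h)).symm a.2 := dif_pos h
  have hs' {p : B × ℝ} (h : p.1 ∈ σ.source) :
      s p = ⟨p.1, Φ.toEquiv (σ p.1) (hqσ h) p.2⟩ := dif_pos h
  have hsp (p : B × ℝ) : (s p).1 = p.1 := by
    by_cases h : p.1 ∈ σ.source <;> simp only [s, h, ↓reduceDIte]
  let e : Trivialization ℝ (TotalSpace.proj : TotalSpace A.F A.Fib → B) :=
    { toFun := fun a => (a.1, c a)
      invFun := s
      source := pr ⁻¹' σ.source
      target := σ.source ×ˢ Set.univ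
      map_source' := fun a ha => ⟨ha, Set.mem_univ _⟩
      map_target' := fun p hp => by
        change (s p).1 ∈ σ.source
        rw [hsp]; exact hp.1
      left_inv' := by
        rintro ⟨b, a⟩ ha
        change b ∈ σ.source at ha
        rw [hs' (p := (b, _)) ha, hc (a := ⟨b, a⟩) ha, LinearEquiv.apply_symm_apply]
      right_inv' := by
        rintro ⟨b, t⟩ ⟨ha, -⟩
        change b ∈ σ.source at ha
        rw [hs' (p := (b, _)) ha, hc (a := ⟨b, _⟩) ha, LinearEquiv.symm_apply_apply]
      open_source := σ.open_source.preimage Φ.continuous_proj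
      open_target := σ.open_source.prod isOpen_univ
      continuousOn_toFun := by
        refine Φ.continuous_proj.continuousOn.prodMk ?_
        rw [continuousOn_iff_continuous_domRestrict]
        have h1 : Continuous (fun a : pr ⁻¹' σ.source =>
            (⟨(σ a.1.1, a.1), hqσ a.2⟩ :
              {p : X × TotalSpace A.F A.Fib // q p.1 = p.2.proj})) :=
          Continuous.subtype_mk ((hcs.comp (f := fun a : pr ⁻¹' σ.source =>
            (⟨a.1.1, a.2⟩ : σ.source)) (Continuous.subtype_mk
              (Φ.continuous_proj.comp continuous_subtype_val) _)).prodMk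
                continuous_subtype_val) _
        convert Φ.continuous_symm.comp h1 using 1
        funext a
        exact hc a.2
      continuousOn_invFun := by
        rw [continuousOn_iff_continuous_domRestrict]
        have h1 : Continuous (fun p : (σ.source ×ˢ Set.univ : Set (B × ℝ)) =>
            (σ p.1.1, p.1.2)) :=
          (hcs.comp (f := fun p : (σ.source ×ˢ Set.univ : Set (B × ℝ)) =>
            (⟨p.1.1, p.2.1⟩ : σ.source)) (by fun_prop)).prodMk (by fun_prop)
        convert Φ.continuous_toEquiv.comp h1 using 1
        funext ⟨⟨b, t⟩, hb, _⟩
        change s (b, t) = (⟨q (σ b), _⟩ : TotalSpace A.F A.Fib)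
        rw [hs' hb]
        have key : ∀ (b' : B) (h : q (σ b) = b'), (⟨b', Φ.toEquiv (σ b) h t⟩ :
            TotalSpace A.F A.Fib) = ⟨q (σ b), Φ.toEquiv (σ b) rfl t⟩ := by
          rintro _ rfl; rfl
        exact key b (hqσ hb)
      baseSet := σ.source
      open_baseSet := σ.open_source
      source_eq := rfl
      target_eq := rfl
      proj_toFun := fun _ _ => rfl }
  refine ⟨e, hq.apply_self_mem_localInverseAt_source, fun b hb => ?_⟩
  have : (fun v : A.Fib b => (e ⟨b, v⟩).2) = (Φ.toEquiv (σ b) (hqσ hb)).symm :=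
    funext fun v => hc (a := ⟨b, v⟩) hb
  rw [this]
  exact (Φ.toEquiv (σ b) (hqσ hb)).symm.toLinearMap.isLinear

end VectorFamily.Frame

/-! ### Frames of the line bundles associated with characters -/

namespace LineFib

variable {X B G : Type} [TopologicalSpace X] [TopologicalSpace B] [Group G] [MulAction G X]
  {q : X → B} (hq : IsQuotientCoveringMap q G) (χ : G →* ℤˣ)

theorem sgn_mul_self (u : ℤˣ) : sgn u * sgn u = 1 := by
  rcases Int.units_eq_one_or u with rfl | rfl <;> simp [sgn_apply]

/-- The linear isomorphism `t ↦ [x, t]`. -/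
def mkEquiv {b : B} (x : X) (hx : q x = b) : ℝ ≃ₗ[ℝ] LineFib hq χ b :=
  LinearEquiv.ofBijective
    (IsLinearMap.mk' (mk x hx : ℝ → LineFib hq χ b)
      ⟨fun s t => by simpa using mk_linear (hq := hq) (χ := χ) hx 1 s t, fun c t => by
        have h0 : (mk x hx 0 : LineFib hq χ b) = 0 := by
          simpa using mk_linear (hq := hq) (χ := χ) hx 1 0 0
        simpa [h0] using mk_linear (hq := hq) (χ := χ) hx c t 0⟩)
    (mk_bijective hx)

/-- The orbit map `X × ℝ → (X × ℝ) / G`. -/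
def total (p : X × ℝ) :
    TotalSpace (VectorFamily.line hq χ).F (VectorFamily.line hq χ).Fib :=
  ⟨q p.1, (mk p.1 rfl p.2 : LineFib hq χ (q p.1))⟩

theorem total_eq {b : B} {x : X} (hx : q x = b) (t : ℝ) :
    total hq χ (x, t) = ⟨b, (mk x hx t : LineFib hq χ b)⟩ := by
  subst hx; rfl

theorem total_smul (g : G) (x : X) (t : ℝ) :
    total hq χ (g • x, sgn (χ g) * t) = total hq χ (x, t) := by
  rw [total_eq hq χ (hq.map_smul g : q (g • x) = q x), mk_smul rfl g, ← total_eq hq χ rfl]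

/-- The base points lie in one orbit; once `p` is moved by the group element between them,
injectivity of $t\mapsto[x,t]$ compares the real coordinates. -/
theorem exists_of_total_eq {p p' : X × ℝ} (h : total hq χ p = total hq χ p') :
    ∃ g : G, p' = (g • p.1, sgn (χ g) * p.2) := by
  obtain ⟨x, t⟩ := p
  obtain ⟨x', t'⟩ := p'
  have hb : q x = q x' := congrArg TotalSpace.proj h
  obtain ⟨g, hg⟩ := hq.apply_eq_iff_mem_orbit.1 hb.symm
  have hg' : g • x = x' := hg
  subst hg'
  refine ⟨g, ?_⟩
  rw [← total_smul hq χ g] at h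
  have h2 : (mk (g • x) rfl (sgn (χ g) * t) : LineFib hq χ (q (g • x))) = mk (g • x) rfl t' :=
    eq_of_heq (TotalSpace.mk.inj h).2
  rw [(mk_bijective rfl).1 h2]

/-- The saturation of an open set is the union of its preimages under the group, which acts
continuously. Openness is needed to test continuity after base change. -/
theorem isOpenQuotientMap_total :
    IsOpenQuotientMap (total hq χ) := by
  have hquot : IsQuotientMap (total hq χ) := by
    refine ⟨⟨rfl⟩, ?_⟩
    rintro ⟨b, a⟩
    obtain ⟨x, rfl⟩ := hq.surjective b
    obtain ⟨t, rfl⟩ := (mk_bijective (hq := hq) (χ := χ) (rfl : q x = q x)).2 a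
    exact ⟨(x, t), rfl⟩
  refine IsOpenQuotientMap.of_isOpenMap_isQuotientMap (fun U hU => ?_) hquot
  rw [← hquot.isOpen_preimage]
  have : total hq χ ⁻¹' (total hq χ '' U) =
      ⋃ g : G, (fun p : X × ℝ => (g • p.1, sgn (χ g) * p.2)) ⁻¹' U := by
    ext p
    simp only [Set.mem_preimage, Set.mem_image, Set.mem_iUnion]
    constructor
    · rintro ⟨p', hp', h⟩
      obtain ⟨g, rfl⟩ := exists_of_total_eq hq χ h.symm
      exact ⟨g, hp'⟩
    · rintro ⟨g, hg⟩
      exact ⟨_, hg, total_smul hq χ g p.1 p.2⟩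
  rw [this]
  have := hq.toContinuousConstSMul
  exact isOpen_iUnion fun g => hU.preimage
    (((continuous_const_smul g).comp continuous_fst).prodMk (continuous_const.mul continuous_snd))

/-- The tautological frame of a line bundle associated with a character. -/
def frame : (VectorFamily.line hq χ).Frame q ℝ where
  continuous_proj := (isOpenQuotientMap_total hq χ).continuous_comp_iff.1
    (hq.continuous.comp continuous_fst)
  toEquiv x hx := mkEquiv hq χ x hx
  continuous_toEquiv := (isOpenQuotientMap_total hq χ).continuous
  continuous_symm := by
    -- The inverse is tested on triples $(x,x',t)$ with $q(x)=q(x')$.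
    have h := ((IsOpenQuotientMap.id (X := X)).prodMap
      (isOpenQuotientMap_total hq χ)).restrictPreimage {p | q p.1 = p.2.proj}
    refine h.continuous_comp_iff.1 (continuous_iff_continuousAt.2 ?_)
    rintro ⟨⟨x, x', t⟩, hx⟩
    change q x = q x' at hx
    obtain ⟨g, hg⟩ := hq.apply_eq_iff_mem_orbit.1 hx
    change g • x' = x at hg
    have := hq.toContinuousConstSMul
    -- The element `g` taking `x'` to `x` also takes `y'` to `y` for nearby pairs, since `q` is
    -- injective on `U`. Thus the coordinate is locally $\chi(g)t$ with `g` fixed.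
    obtain ⟨U, hU, hxU, hinj⟩ := hq.isCoveringMap.isLocalHomeomorph.isLocallyInjective x
    have hcont : ContinuousAt (fun p : (Prod.map id (total hq χ) ⁻¹' {p | q p.1 = p.2.proj} :
        Set (X × X × ℝ)) => sgn (χ g) * p.1.2.2) ⟨(x, x', t), hx⟩ := by fun_prop
    refine hcont.congr ?_
    have e1 : ∀ᶠ p : (Prod.map id (total hq χ) ⁻¹' {p | q p.1 = p.2.proj} :
        Set (X × X × ℝ)) in 𝓝 ⟨(x, x', t), hx⟩, p.1.1 ∈ U :=
      ContinuousAt.eventually_mem (f := fun p : (Prod.map id (total hq χ) ⁻¹'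
        {p | q p.1 = p.2.proj} : Set (X × X × ℝ)) => p.1.1) (by fun_prop) (hU.mem_nhds hxU)
    have e2 : ∀ᶠ p : (Prod.map id (total hq χ) ⁻¹' {p | q p.1 = p.2.proj} :
        Set (X × X × ℝ)) in 𝓝 ⟨(x, x', t), hx⟩, g • p.1.2.1 ∈ U :=
      ContinuousAt.eventually_mem (f := fun p : (Prod.map id (total hq χ) ⁻¹'
        {p | q p.1 = p.2.proj} : Set (X × X × ℝ)) => g • p.1.2.1)
          (Continuous.continuousAt (by fun_prop)) (hU.mem_nhds (by rwa [hg]))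
    filter_upwards [e1, e2] with ⟨⟨y, y', s⟩, hy⟩ h1 h2
    change q y = q y' at hy
    have h3 : g • y' = y := hinj h2 h1 ((hq.map_smul g).trans hy.symm)
    subst h3
    refine (LinearEquiv.symm_apply_eq _).2 ?_ |>.symm
    exact (mk_smul (hq := hq) (χ := χ) rfl g hy s).symm

theorem frame_toEquiv_smul (g : G) (x : X) {b : B} (h : q x = b) (h' : q (g • x) = b) (t : ℝ) :
    (frame hq χ).toEquiv (g • x) h' (sgn (χ g) * t) = (frame hq χ).toEquiv x h t :=
  mk_smul (hq := hq) h g h' t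

end LineFib

/-! ### Smoothness of orbit maps, of maps into products and of radial projections -/

section Orbit

variable {E H M G : Type*} [NormedAddCommGroup E] [NormedSpace ℝ E]
  [TopologicalSpace H] (I : ModelWithCorners ℝ E H) (r : ℕ∞ω)
  [TopologicalSpace M] [ChartedSpace H M] [IsManifold I r M] [Group G] [MulAction G M]
  [ProperlyDiscontinuousSMul G M] [ContinuousConstSMul G M] [IsCancelSMul G M]
  [T2Space M] [LocallyCompactSpace M]

/-- The orbit map of a free properly discontinuous action by `C^r` maps is `C^r`, and has `C^r`
local sections. -/
theorem orbitMk_contMDiffAt_and_exists_section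
    (hG : ∀ g : G, ContMDiff I I r (fun x : M => g • x)) (x : M) :
    ContMDiffAt I I r (Quotient.mk (MulAction.orbitRel G M) :
      M → MulAction.orbitRel.Quotient G M) x ∧
    ∃ σ : MulAction.orbitRel.Quotient G M → M,
      ContMDiffAt I I r σ (Quotient.mk (MulAction.orbitRel G M) x) ∧
      ∀ᶠ y in 𝓝 x, σ (Quotient.mk (MulAction.orbitRel G M) y) = y := by
  have hman : IsManifold I r (MulAction.orbitRel.Quotient G M) := orbitQuotient_isManifold I r hG
  have hq : IsQuotientCoveringMap (Quotient.mk (MulAction.orbitRel G M)) G :=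
    isQuotientCoveringMap_quotientMk_of_properlyDiscontinuousSMul
  have hl : IsLocalHomeomorph (Quotient.mk (MulAction.orbitRel G M)) :=
    hq.isCoveringMap.isLocalHomeomorph
  have hid (x : M) : ∀ᶠ y in 𝓝 x, hl.localInverseAt x (Quotient.mk _ y) = y := by
    filter_upwards [(hl.localInverseAt x).open_target.mem_nhds hl.self_mem_localInverseAt_target]
      with y hy
    have h := (hl.localInverseAt x).right_inv hy
    rwa [hl.localInverseAt_symm] at h
  have hsmul (x : M) (g : G) (a : M) (ha : g • x = a) :
      ∀ᶠ y in 𝓝 x, hl.localInverseAt a (Quotient.mk _ y) = g • y := by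
    subst ha
    have h1 : ContinuousAt (fun y : M => g • y) x := (continuous_const_smul g).continuousAt
    filter_upwards [h1.eventually (hid (g • x))] with y hy
    rw [← hy, hq.map_smul g]
  -- The chart of the orbit space at the class of `x` is built from the chosen representative `a`,
  -- not from `x`; below, `g` moves `x` to `a`.
  let a : M := (Quotient.mk_surjective (s := MulAction.orbitRel G M)).hasRightInverse.choose
    (Quotient.mk _ x)
  have ha : (Quotient.mk (MulAction.orbitRel G M) a) = Quotient.mk _ x :=
    (Quotient.mk_surjective (s := MulAction.orbitRel G M)).hasRightInverse.choose_spec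
      (Quotient.mk _ x)
  have hcoe (w : MulAction.orbitRel.Quotient G M) :
      extChartAt I (Quotient.mk (MulAction.orbitRel G M) x) w =
        extChartAt I a (hl.localInverseAt a w) := rfl
  have hsymm (z : E) : (extChartAt I (Quotient.mk (MulAction.orbitRel G M) x)).symm z =
      Quotient.mk _ ((extChartAt I a).symm z) := by
    change (hl.localInverseAt a).symm _ = _
    rw [hl.localInverseAt_symm]; rfl
  obtain ⟨g, hg⟩ := hq.apply_eq_iff_mem_orbit.1 ha
  have hg : g • x = a := hg
  constructor
  · rw [contMDiffAt_iff_target]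
    refine ⟨hq.continuous.continuousAt, ?_⟩
    have h : ContMDiffAt I 𝓘(ℝ, E) r (fun y : M => extChartAt I a (g • y)) x := by
      have h1 : ContMDiffAt I 𝓘(ℝ, E) r (extChartAt I a) (g • x) := by
        rw [hg]; exact contMDiffAt_extChartAt
      exact h1.comp x (hG g).contMDiffAt
    refine h.congr_of_eventuallyEq ?_
    filter_upwards [hsmul x g a hg] with y hy
    rw [Function.comp_apply, hcoe, hy]
  · refine ⟨hl.localInverseAt x, ?_, hid x⟩
    rw [contMDiffAt_iff_source]
    have hz : extChartAt I (Quotient.mk (MulAction.orbitRel G M) x)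
        (Quotient.mk (MulAction.orbitRel G M) x) = extChartAt I a a := by
      rw [hcoe, (hsmul x g a hg).self_of_nhds, hg]
    rw [hz]
    have h0 : ContMDiffWithinAt 𝓘(ℝ, E) I r (extChartAt I a).symm (Set.range I)
        (extChartAt I a a) := contMDiffWithinAt_extChartAt_symm_range a (mem_extChartAt_target a)
    -- Read in the chart at `a`, the local section through `x` is translation by `g⁻¹`.
    have h : ContMDiffWithinAt 𝓘(ℝ, E) I r (fun z => g⁻¹ • (extChartAt I a).symm z) (Set.range I)
        (extChartAt I a a) := (hG g⁻¹).contMDiffAt.comp_contMDiffWithinAt _ h0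
    have hga : g⁻¹ • (extChartAt I a).symm (extChartAt I a a) = x := by
      rw [extChartAt_to_inv, ← hg, inv_smul_smul]
    have hev := h0.continuousWithinAt.eventually (hsmul _ g⁻¹ x hga)
    refine h.congr_of_eventuallyEq ?_ ?_
    · filter_upwards [hev] with z hz
      rw [Function.comp_apply, hsymm, hz]
    · rw [Function.comp_apply, hsymm]
      exact (hsmul _ g⁻¹ x hga).self_of_nhds

end Orbit

section Pi

variable {ι : Type*} [Fintype ι] {E H M : ι → Type*} [∀ i, NormedAddCommGroup (E i)]
  [∀ i, NormedSpace ℝ (E i)] [∀ i, TopologicalSpace (H i)]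
  (I : ∀ i, ModelWithCorners ℝ (E i) (H i)) (r : ℕ∞ω) [∀ i, TopologicalSpace (M i)]
  [∀ i, ChartedSpace (H i) (M i)] [∀ i, IsManifold (I i) r (M i)]

include I in
/-- A map into a finite product of manifolds is `C^r` if its components are. -/
theorem contMDiffAt_pi_of_components {E' H' N : Type*} [NormedAddCommGroup E'] [NormedSpace ℝ E']
    [TopologicalSpace H'] {J : ModelWithCorners ℝ E' H'} [TopologicalSpace N] [ChartedSpace H' N]
    {f : N → ∀ i, M i} {x : N} (hf : ∀ i, ContMDiffAt J (I i) r (fun y => f y i) x) :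
    ContMDiffAt J (ModelWithCorners.pi I) r f x := by
  have := pi_isManifold (M := M) I r
  rw [contMDiffAt_iff_target]
  refine ⟨continuousAt_pi.2 fun i => (hf i).continuousAt, ?_⟩
  rw [contMDiffAt_pi_space]
  intro i
  exact ContMDiffAt.comp (g := extChartAt (I i) (f x i)) (f := fun y => f y i) x
    contMDiffAt_extChartAt (hf i)

/-- The projections of a finite product of manifolds are `C^r`. -/
theorem contMDiffAt_eval (i : ι) (x : ∀ i, M i) :
    ContMDiffAt (ModelWithCorners.pi I) (I i) r (fun y : ∀ i, M i => y i) x := by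
  have := pi_isManifold (M := M) I r
  rw [contMDiffAt_iff_target]
  refine ⟨(continuous_apply i).continuousAt, ?_⟩
  exact ((ContinuousLinearMap.proj (R := ℝ) (φ := E) i).contMDiff.contMDiffAt (n := r)).comp x
    (contMDiffAt_extChartAt (I := ModelWithCorners.pi I) (n := r) (x := x))

end Pi

namespace Sph

variable {d : ℕ}

/-- The radial projection `v ↦ v / ‖v‖`, with an arbitrary value at the origin. -/
def normalize (v : EuclideanSpace ℝ (Fin (d + 1))) : Sph d :=
  if h : v = 0 then ⟨EuclideanSpace.single 0 1, by simp⟩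
  else ⟨‖v‖⁻¹ • v, by simp [norm_smul, h]⟩

theorem coe_normalize {v : EuclideanSpace ℝ (Fin (d + 1))} (h : v ≠ 0) :
    (normalize v : EuclideanSpace ℝ (Fin (d + 1))) = ‖v‖⁻¹ • v := by
  rw [normalize, dif_neg h]

theorem coe_ne_zero (x : Sph d) : (x : EuclideanSpace ℝ (Fin (d + 1))) ≠ 0 :=
  ne_zero_of_mem_unit_sphere x

theorem normalize_coe (x : Sph d) : normalize (x : EuclideanSpace ℝ (Fin (d + 1))) = x := by
  ext1
  rw [coe_normalize x.coe_ne_zero, norm_eq_of_mem_sphere, inv_one, one_smul]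

theorem normalize_smul (g : ℤˣ) {v : EuclideanSpace ℝ (Fin (d + 1))} (h : v ≠ 0) :
    normalize (sgn g • v) = g • normalize v := by
  have hg : sgn g ≠ 0 := by
    rcases Int.units_eq_one_or g with rfl | rfl <;> simp [sgn_apply]
  have hn : ‖sgn g‖ = 1 := by
    rcases Int.units_eq_one_or g with rfl | rfl <;> simp [sgn_apply]
  ext1
  rw [coe_normalize (smul_ne_zero hg h), coe_smul, coe_normalize h, norm_smul, hn, one_mul,
    smul_comm, sgn_apply]

theorem contDiffAt_inv_norm_smul {v : EuclideanSpace ℝ (Fin (d + 1))} (h : v ≠ 0) :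
    ContDiffAt ℝ ω (fun w : EuclideanSpace ℝ (Fin (d + 1)) => ‖w‖⁻¹ • w) v :=
  ((contDiffAt_norm ℝ h).inv (norm_ne_zero_iff.2 h)).smul contDiffAt_id

/-- The chart of the sphere at a point is stereographic projection from its antipode. That
projection extends smoothly to the ambient space off a hyperplane, so it can be composed with
$w\mapsto w/\|w\|$ there. -/
theorem contMDiffAt_normalize {v : EuclideanSpace ℝ (Fin (d + 1))} (h : v ≠ 0) :
    ContMDiffAt 𝓘(ℝ, EuclideanSpace ℝ (Fin (d + 1))) (𝓡 d) ω (normalize (d := d)) v := by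
  have hev : ∀ᶠ w in 𝓝 v, (normalize w : EuclideanSpace ℝ (Fin (d + 1))) = ‖w‖⁻¹ • w := by
    filter_upwards [isOpen_ne.mem_nhds h] with w hw
    exact coe_normalize hw
  have hs := (contDiffAt_inv_norm_smul h).congr_of_eventuallyEq hev
  rw [contMDiffAt_iff_target]
  refine ⟨(Topology.IsInducing.subtypeVal.continuousAt_iff).2 hs.continuousAt, ?_⟩
  have := Fact.mk (@finrank_euclideanSpace_fin ℝ _ (d + 1))
  let u : Sph d := -normalize v
  have hu : innerSL ℝ (u : EuclideanSpace ℝ (Fin (d + 1)))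
      (normalize v : EuclideanSpace ℝ (Fin (d + 1))) ≠ 1 := by
    simp [u]
    norm_num
  have hopen : IsOpen {x : EuclideanSpace ℝ (Fin (d + 1)) |
      innerSL ℝ (u : EuclideanSpace ℝ (Fin (d + 1))) x ≠ 1} :=
    isOpen_ne.preimage (innerSL ℝ (u : EuclideanSpace ℝ (Fin (d + 1)))).continuous
  have h1 : ContDiffAt ℝ ω (stereoToFun (u : EuclideanSpace ℝ (Fin (d + 1))))
      (normalize v : EuclideanSpace ℝ (Fin (d + 1))) :=
    contDiffOn_stereoToFun.contDiffAt (hopen.mem_nhds hu)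
  let U := (OrthonormalBasis.fromOrthogonalSpanSingleton (𝕜 := ℝ) d
    (ne_zero_of_mem_unit_sphere u)).repr
  exact (U.contDiff.contDiffAt.comp v (h1.comp v hs)).contMDiffAt

end Sph

/-! ### Tangent maps -/

section TangentMap

variable {E H M E' H' M' : Type*} [NormedAddCommGroup E] [NormedSpace ℝ E]
  [TopologicalSpace H] {I : ModelWithCorners ℝ E H} [TopologicalSpace M] [ChartedSpace H M]
  [IsManifold I 1 M] [NormedAddCommGroup E'] [NormedSpace ℝ E']
  [TopologicalSpace H'] {I' : ModelWithCorners ℝ E' H'} [TopologicalSpace M'] [ChartedSpace H' M']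
  [IsManifold I' 1 M']

/-- Being $C^1$ at a point gives $C^1$ on an open neighbourhood, where the tangent map within that
set is continuous and agrees with the full one. -/
theorem ContMDiffAt.continuousAt_tangentMap {f : M → M'} {p : TangentBundle I M}
    (hf : ContMDiffAt I I' 1 f p.1) : ContinuousAt (tangentMap I I' f) p := by
  obtain ⟨u, hu, huo, hpu⟩ := eventually_nhds_iff.1
    ((contMDiffAt_iff_contMDiffAt_nhds (by simp)).1 hf)
  have h1 : ContMDiffOn I I' 1 f u := fun y hy => (hu y hy).contMDiffWithinAt
  have h2 := h1.continuousOn_tangentMapWithin le_rfl huo.uniqueMDiffOn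
  have h3 : IsOpen (TotalSpace.proj ⁻¹' u : Set (TangentBundle I M)) :=
    huo.preimage (FiberBundle.continuous_proj E (TangentSpace I))
  refine (h2.congr fun q hq => ?_).continuousAt (h3.mem_nhds hpu)
  exact (tangentMapWithin_eq_tangentMap (huo.uniqueMDiffOn q.1 hq)
    ((hu q.1 hq).mdifferentiableAt one_ne_zero)).symm

theorem ContMDiffAt.continuousAt_mfderiv_apply {S : M → E'} {p : TangentBundle I M}
    (hS : ContMDiffAt I 𝓘(ℝ, E') 1 S p.1) :
    ContinuousAt (fun q : TangentBundle I M => (mfderiv I 𝓘(ℝ, E') S q.1 q.2 : E')) p :=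
  ((contMDiff_snd_tangentBundle_modelSpace E' 𝓘(ℝ, E') (n := 0)).continuous.continuousAt).comp
    hS.continuousAt_tangentMap

theorem ContMDiffAt.continuousAt_tangentMap_model {R : E' → M} {v w : E'}
    (hR : ContMDiffAt 𝓘(ℝ, E') I 1 R v) :
    ContinuousAt (fun q : E' × E' => (⟨R q.1, mfderiv 𝓘(ℝ, E') I R q.1 q.2⟩ : TangentBundle I M))
      (v, w) :=
  ContinuousAt.comp (f := (tangentBundleModelSpaceHomeomorph 𝓘(ℝ, E')).symm) (x := (v, w))
    (ContMDiffAt.continuousAt_tangentMap (p := (⟨v, w⟩ : TangentBundle 𝓘(ℝ, E') E')) hR)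
    ((tangentBundleModelSpaceHomeomorph 𝓘(ℝ, E')).symm.continuous.continuousAt)

end TangentMap

/-- The derivative of the radial projection at a point of the unit sphere. -/
theorem hasFDerivAt_inv_norm_smul {F : Type*} [NormedAddCommGroup F] [InnerProductSpace ℝ F]
    {x : F} (hx : ‖x‖ = 1) :
    HasFDerivAt (fun v : F => ‖v‖⁻¹ • v)
      (ContinuousLinearMap.id ℝ F - (innerSL ℝ x).smulRight x) x := by
  -- The norm is differentiated as the square root of its square.
  have h1 : HasFDerivAt (fun v : F => ‖v‖ ^ 2) (2 • innerSL ℝ x) x :=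
    (hasStrictFDerivAt_norm_sq x).hasFDerivAt
  have h2 := (hasDerivAt_inv (x := √(‖x‖ ^ 2)) (by simp [hx])).comp_hasFDerivAt x
    (h1.sqrt (by simp [hx]))
  have h3 := h2.smul (hasFDerivAt_id x)
  convert h3 using 1
  · funext v; simp
  · ext v
    simp [hx]
    module

theorem Sph.contMDiff_coe {d : ℕ} : ContMDiff (𝓡 d) 𝓘(ℝ, EuclideanSpace ℝ (Fin (d + 1))) ω
    (Subtype.val : Sph d → EuclideanSpace ℝ (Fin (d + 1))) :=
  have := Fact.mk (@finrank_euclideanSpace_fin ℝ _ (d + 1))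
  contMDiff_coe_sphere

/-! ### The radial map from Euclidean space to `P_S` and its local sections -/

namespace PS

variable {k l : ℕ} (m : Fin k → ℕ) (n : Fin l → ℕ)

/-- The Euclidean space containing `S(m) × ∏ S^{n_j}`. -/
abbrev Ambient : Type :=
  (∀ i, EuclideanSpace ℝ (Fin (m i + 1))) × (∀ j, EuclideanSpace ℝ (Fin (n j + 1)))

variable {m n}

/-- The inclusion of `S(m) × ∏ S^{n_j}` into Euclidean space. -/
def incl (p : SphProd m × SphProd n) : Ambient m n := (fun i => p.1 i, fun j => p.2 j)

theorem continuous_incl : Continuous (incl (m := m) (n := n)) := by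
  unfold incl; fun_prop

/-- The radial projection of Euclidean space, followed by the orbit map. -/
def retr (v : Ambient m n) : PS m n :=
  PS.mk' m n (fun i => Sph.normalize (v.1 i), fun j => Sph.normalize (v.2 j))

theorem retr_incl (p : SphProd m × SphProd n) : retr (incl p) = PS.mk' m n p := by
  simp only [retr, incl, Sph.normalize_coe]

theorem eventually_ne_zero (p : SphProd m × SphProd n) :
    ∀ᶠ v in 𝓝 (incl p), (∀ i, v.1 i ≠ 0) ∧ (∀ j, v.2 j ≠ 0) := by
  refine (Filter.eventually_all.2 fun i => ?_).and (Filter.eventually_all.2 fun j => ?_)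
  · exact ContinuousAt.eventually_ne (g := fun v : Ambient m n => v.1 i) (by fun_prop)
      (p.1 i).coe_ne_zero
  · exact ContinuousAt.eventually_ne (g := fun v : Ambient m n => v.2 j) (by fun_prop)
      (p.2 j).coe_ne_zero

theorem contDiffAt_fst_apply (i : Fin k) (v : Ambient m n) :
    ContDiffAt ℝ ω (fun v : Ambient m n => v.1 i) v :=
  ((ContinuousLinearMap.proj (R := ℝ)
    (φ := fun i => EuclideanSpace ℝ (Fin (m i + 1))) i).contDiff.comp contDiff_fst).contDiffAt

theorem contDiffAt_snd_apply (j : Fin l) (v : Ambient m n) :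
    ContDiffAt ℝ ω (fun v : Ambient m n => v.2 j) v :=
  ((ContinuousLinearMap.proj (R := ℝ)
    (φ := fun j => EuclideanSpace ℝ (Fin (n j + 1))) j).contDiff.comp contDiff_snd).contDiffAt

variable [NeZero k]

theorem mk_contMDiffAt_and_exists_section (p : SphProd m × RPProd n) :
    ContMDiffAt (PS.model m n) (PS.model m n) ω (PS.mk m n) p ∧
    ∃ σ : PS m n → SphProd m × RPProd n,
      ContMDiffAt (PS.model m n) (PS.model m n) ω σ (PS.mk m n p) ∧
      ∀ᶠ y in 𝓝 p, σ (PS.mk m n y) = y := by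
  have := pi_isManifold (M := fun i => Sph (m i)) (fun i => 𝓡 (m i)) ω
  have := pi_isManifold (M := fun i => RP (n i)) (fun i => 𝓡 (n i)) ω
  refine orbitMk_contMDiffAt_and_exists_section (PS.model m n) ω (fun g => ?_) p
  refine ContMDiff.prodMap (f := fun x : SphProd m => g • x) (g := fun y : RPProd n => g • y) ?_ ?_
  · exact contMDiff_piMap _ _ (fun i (x : Sph (m i)) => g • x) fun i => Sph.contMDiff_smul g
  · refine contMDiff_piMap _ _ (fun i (x : RP (n i)) => g • x) fun i => ?_
    simp only [RP.smul_eq]; exact contMDiff_id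

theorem contMDiffAt_retr (p : SphProd m × SphProd n) :
    ContMDiffAt 𝓘(ℝ, Ambient m n) (PS.model m n) ω (retr (m := m) (n := n)) (incl p) := by
  have h1 : ContMDiffAt 𝓘(ℝ, Ambient m n) (ModelWithCorners.pi fun i => 𝓡 (m i)) ω
      (fun v : Ambient m n => (fun i => Sph.normalize (v.1 i) : SphProd m)) (incl p) := by
    refine contMDiffAt_pi_of_components _ _ fun i => ?_
    exact ContMDiffAt.comp (incl p) (Sph.contMDiffAt_normalize (p.1 i).coe_ne_zero)
      (contDiffAt_fst_apply i _).contMDiffAt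
  have h2 : ContMDiffAt 𝓘(ℝ, Ambient m n) (ModelWithCorners.pi fun i => 𝓡 (n i)) ω
      (fun v : Ambient m n => (fun j => RP.mk (Sph.normalize (v.2 j)) : RPProd n)) (incl p) := by
    refine contMDiffAt_pi_of_components _ _ fun j => ?_
    exact ContMDiffAt.comp (g := RP.mk) (incl p)
      (orbitMk_contMDiffAt_and_exists_section (𝓡 (n j)) ω Sph.contMDiff_smul _).1
      (ContMDiffAt.comp (incl p) (Sph.contMDiffAt_normalize (p.2 j).coe_ne_zero)
        (contDiffAt_snd_apply j _).contMDiffAt)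
  exact ContMDiffAt.comp (g := PS.mk m n) (incl p) (mk_contMDiffAt_and_exists_section _).1
    (h1.prodMk h2)

/-- Local sections of the orbit map and of each $S^{n_j}\to\mathbb RP^{n_j}$ compose to a lift into
Euclidean space. Since `S ∘ retr` is locally the explicit radial projection, derivatives can be
computed without charts of $P_S$. -/
theorem exists_section (p : SphProd m × SphProd n) :
    ∃ S : PS m n → Ambient m n,
      ContMDiffAt (PS.model m n) 𝓘(ℝ, Ambient m n) ω S (PS.mk' m n p) ∧
      ∀ᶠ v in 𝓝 (incl p), S (retr v) =
        (fun i => ‖v.1 i‖⁻¹ • v.1 i, fun j => ‖v.2 j‖⁻¹ • v.2 j) := by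
  obtain ⟨-, σ, hσ, hσ'⟩ :=
    mk_contMDiffAt_and_exists_section (p.1, fun j => RP.mk (p.2 j))
  have h (j : Fin l) :=
    (orbitMk_contMDiffAt_and_exists_section (𝓡 (n j)) ω Sph.contMDiff_smul (p.2 j)).2
  choose τ hτ hτ' using h
  have hσp : σ (PS.mk' m n p) = (p.1, fun j => RP.mk (p.2 j)) := hσ'.self_of_nhds
  refine ⟨fun b => (fun i => (σ b).1 i, fun j => τ j ((σ b).2 j)), ?_, ?_⟩
  · refine ContMDiffAt.prodMk_space ?_ ?_
    · refine contMDiffAt_pi_space.2 fun i => ?_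
      refine ContMDiffAt.comp (g := (Subtype.val : Sph (m i) → _)) (PS.mk' m n p)
        Sph.contMDiff_coe.contMDiffAt ?_
      refine ContMDiffAt.comp (g := fun y : SphProd m => y i) (PS.mk' m n p)
        (contMDiffAt_eval (fun i => 𝓡 (m i)) ω i _) ?_
      exact contMDiffAt_fst.comp (PS.mk' m n p) hσ
    · refine contMDiffAt_pi_space.2 fun j => ?_
      refine ContMDiffAt.comp (g := (Subtype.val : Sph (n j) → _)) (PS.mk' m n p)
        Sph.contMDiff_coe.contMDiffAt ?_
      refine ContMDiffAt.comp (g := τ j) (PS.mk' m n p) (by rw [hσp]; exact hτ j) ?_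
      refine ContMDiffAt.comp (g := fun y : RPProd n => y j) (PS.mk' m n p)
        (contMDiffAt_eval (fun j => 𝓡 (n j)) ω j _) ?_
      exact contMDiffAt_snd.comp (PS.mk' m n p) hσ
  · have c1 (j : Fin l) : ContinuousAt (fun v : Ambient m n => Sph.normalize (v.2 j)) (incl p) :=
      ContinuousAt.comp (g := Sph.normalize) (f := fun v : Ambient m n => v.2 j) (x := incl p)
        (Sph.contMDiffAt_normalize (p.2 j).coe_ne_zero).continuousAt (by fun_prop)
    have c2 (i : Fin k) : ContinuousAt (fun v : Ambient m n => Sph.normalize (v.1 i)) (incl p) :=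
      ContinuousAt.comp (g := Sph.normalize) (f := fun v : Ambient m n => v.1 i) (x := incl p)
        (Sph.contMDiffAt_normalize (p.1 i).coe_ne_zero).continuousAt (by fun_prop)
    have c3 : ContinuousAt (fun v : Ambient m n => ((fun i => Sph.normalize (v.1 i),
        fun j => RP.mk (Sph.normalize (v.2 j))) : SphProd m × RPProd n)) (incl p) :=
      (continuousAt_pi.2 c2).prodMk (continuousAt_pi.2 fun j =>
        ContinuousAt.comp (g := RP.mk) continuous_quotient_mk'.continuousAt (c1 j))
    have e1 : ∀ᶠ v : Ambient m n in 𝓝 (incl p), ∀ j, τ j (RP.mk (Sph.normalize (v.2 j))) =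
        Sph.normalize (v.2 j) :=
      Filter.eventually_all.2 fun j => (c1 j).eventually (by
        simp only [incl, Sph.normalize_coe]; exact hτ' j)
    have e2 := c3.eventually (p := fun y => σ (PS.mk m n y) = y) (by
      simp only [incl, Sph.normalize_coe]; exact hσ')
    filter_upwards [e1, e2, eventually_ne_zero p] with v h1 h2 h3
    have h2' : σ (retr v) = _ := h2
    simp only [h2', h1, Sph.coe_normalize (h3.1 _), Sph.coe_normalize (h3.2 _)]

end PS

/-! ### The frame of `T P_S ⊕ (k + ℓ) ε` -/

namespace PS

variable {k l : ℕ} {m : Fin k → ℕ} {n : Fin l → ℕ}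

/-- The inner products of the components of `w` with those of `p`. -/
def radial (p : SphProd m × SphProd n) : Ambient m n →ₗ[ℝ] (Fin (k + l) → ℝ) where
  toFun w := Fin.addCases (fun i => inner ℝ (p.1 i).1 (w.1 i)) (fun j => inner ℝ (p.2 j).1 (w.2 j))
  map_add' v w := by
    funext a
    refine Fin.addCases (fun i => ?_) (fun j => ?_) a <;> simp [inner_add_right]
  map_smul' c w := by
    funext a
    refine Fin.addCases (fun i => ?_) (fun j => ?_) a <;> simp [inner_smul_right]

/-- The vector whose components are the multiples of the components of `p` by those of `t`. -/
def radialInv (p : SphProd m × SphProd n) (t : Fin (k + l) → ℝ) : Ambient m n :=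
  (fun i => t (Fin.castAdd l i) • (p.1 i).1, fun j => t (Fin.natAdd k j) • (p.2 j).1)

theorem continuous_radial :
    Continuous (fun q : (SphProd m × SphProd n) × Ambient m n => radial q.1 q.2) := by
  refine continuous_pi fun a => ?_
  refine Fin.addCases (fun i => ?_) (fun j => ?_) a
  · simp only [radial, LinearMap.coe_mk, AddHom.coe_mk, Fin.addCases_left]
    fun_prop
  · simp only [radial, LinearMap.coe_mk, AddHom.coe_mk, Fin.addCases_right]
    fun_prop

theorem continuous_radialInv :
    Continuous (fun q : (SphProd m × SphProd n) × (Fin (k + l) → ℝ) => radialInv q.1 q.2) := by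
  unfold radialInv
  fun_prop

/-- The action of `ℤ₂ × ℤ₂^ℓ` on the ambient Euclidean space. -/
def ambientAct (g : ℤˣ × (Fin l → ℤˣ)) : Ambient m n →L[ℝ] Ambient m n :=
  (ContinuousLinearMap.pi fun i => sgn g.1 •
    (ContinuousLinearMap.proj i).comp (ContinuousLinearMap.fst ℝ _ _)).prod
  (ContinuousLinearMap.pi fun j => sgn (g.1 * g.2 j) •
    (ContinuousLinearMap.proj j).comp (ContinuousLinearMap.snd ℝ _ _))

theorem ambientAct_apply (g : ℤˣ × (Fin l → ℤˣ)) (v : Ambient m n) :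
    ambientAct g v = (fun i => sgn g.1 • v.1 i, fun j => sgn (g.1 * g.2 j) • v.2 j) := rfl

theorem incl_smul (g : ℤˣ × (Fin l → ℤˣ)) (p : SphProd m × SphProd n) :
    incl (g • p) = ambientAct g (incl p) := rfl

/-- Both arguments of each inner product acquire the same sign, and its square is 1. -/
theorem radial_smul (g : ℤˣ × (Fin l → ℤˣ)) (p : SphProd m × SphProd n) (w : Ambient m n) :
    radial (g • p) (ambientAct g w) = radial p w := by
  funext a
  refine Fin.addCases (fun i => ?_) (fun j => ?_) a
  · have h : ((g • p).1 i).1 = sgn g.1 • (p.1 i).1 := rfl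
    simp only [radial, LinearMap.coe_mk, AddHom.coe_mk, Fin.addCases_left, h, ambientAct_apply,
      inner_smul_left, inner_smul_right]
    rw [← mul_assoc]
    simp [LineFib.sgn_mul_self]
  · have h : ((g • p).2 j).1 = sgn (g.1 * g.2 j) • (p.2 j).1 := rfl
    simp only [radial, LinearMap.coe_mk, AddHom.coe_mk, Fin.addCases_right, h, ambientAct_apply,
      inner_smul_left, inner_smul_right]
    rw [← mul_assoc]
    simp [LineFib.sgn_mul_self, -map_mul]

/-- Each of the $k+\ell$ spheres has codimension one in its Euclidean space. -/
theorem finrank_ambient :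
    Module.finrank ℝ (Ambient m n) = Module.finrank ℝ (PS.E m n × (Fin (k + l) → ℝ)) := by
  simp only [Module.finrank_prod, Module.finrank_pi_fintype, finrank_euclideanSpace_fin,
    Module.finrank_self, Finset.sum_add_distrib, Finset.sum_const, Finset.card_univ,
    Fintype.card_fin, smul_eq_mul, mul_one]
  ring

variable [NeZero k]

/-- Only a local statement is claimed, since the default value of `Sph.normalize` at the origin is
not equivariant. -/
theorem eventually_retr_act (g : ℤˣ × (Fin l → ℤˣ)) (p : SphProd m × SphProd n) :
    ∀ᶠ v in 𝓝 (incl p), retr (ambientAct g v) = retr v := by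
  filter_upwards [eventually_ne_zero p] with v hv
  have : retr (ambientAct g v) = PS.mk' m n (g • (fun i => Sph.normalize (v.1 i),
      fun j => Sph.normalize (v.2 j))) := by
    simp only [retr, ambientAct_apply, Sph.normalize_smul _ (hv.1 _), Sph.normalize_smul _ (hv.2 _)]
    rfl
  rw [this, (PS.isQuotientCoveringMap_mk' m n).map_smul]
  rfl

/-- The derivative of `PS.retr` at a point of `S(m) × ∏ S^{n_j}`. -/
def dRetr (p : SphProd m × SphProd n) : Ambient m n →L[ℝ] PS.E m n :=
  mfderiv 𝓘(ℝ, Ambient m n) (PS.model m n) (retr (m := m) (n := n)) (incl p)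

/-- The derivative of a map from `P_S` to the ambient Euclidean space. -/
def dSec (S : PS m n → Ambient m n) (b : PS m n) : PS.E m n →L[ℝ] Ambient m n :=
  mfderiv (PS.model m n) 𝓘(ℝ, Ambient m n) S b

/-- This is the chain rule applied to the local identity `retr ∘ ambientAct g = retr`. -/
theorem dRetr_smul (g : ℤˣ × (Fin l → ℤˣ)) (p : SphProd m × SphProd n) (w : Ambient m n) :
    dRetr (g • p) (ambientAct g w) = dRetr p w := by
  have h1 : mfderiv 𝓘(ℝ, Ambient m n) (PS.model m n) (retr ∘ ambientAct g) (incl p) =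
      mfderiv 𝓘(ℝ, Ambient m n) (PS.model m n) retr (incl p) :=
    Filter.EventuallyEq.mfderiv_eq (eventually_retr_act g p)
  have h2 : MDifferentiableAt 𝓘(ℝ, Ambient m n) (PS.model m n) (retr (m := m) (n := n))
      (ambientAct g (incl p)) := by
    rw [← incl_smul]
    exact (contMDiffAt_retr (g • p)).mdifferentiableAt (by simp)
  have h3 := mfderiv_comp (incl p) h2 (ambientAct g).mdifferentiableAt
  rw [h1, ContinuousLinearMap.mfderiv_eq] at h3
  exact (congrArg (fun L : Ambient m n →L[ℝ] PS.E m n => L w) h3).symm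

/-- The derivative of $v\mapsto v/\|v\|$ at a unit vector $x$ is the orthogonal projection $w\mapsto
w-\langle x,w\rangle x$, and by the chain rule it factors through `dRetr`; `radialInv` restores the
lost component. One `S` serves all `p'` near `p`, which is what continuity of the inverse needs. -/
theorem eventually_dSec_dRetr {p : SphProd m × SphProd n} {S : PS m n → Ambient m n}
    (hS : ContMDiffAt (PS.model m n) 𝓘(ℝ, Ambient m n) ω S (PS.mk' m n p))
    (hS' : ∀ᶠ v in 𝓝 (incl p), S (retr v) =
        (fun i => ‖v.1 i‖⁻¹ • v.1 i, fun j => ‖v.2 j‖⁻¹ • v.2 j)) :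
    ∀ᶠ p' in 𝓝 p, ∀ w, dSec S (PS.mk' m n p') (dRetr p' w) + radialInv p' (radial p' w) = w := by
  have e1 := (PS.isQuotientCoveringMap_mk' m n).continuous.continuousAt.eventually
    ((contMDiffAt_iff_contMDiffAt_nhds (by simp)).1 hS)
  have e2 := continuous_incl.continuousAt.eventually hS'.eventually_nhds
  filter_upwards [e1, e2] with p' h1 h2 w
  have d1 : HasFDerivAt (fun v : Ambient m n =>
      ((fun i => ‖v.1 i‖⁻¹ • v.1 i, fun j => ‖v.2 j‖⁻¹ • v.2 j) : Ambient m n))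
      (ContinuousLinearMap.prod
        (ContinuousLinearMap.pi fun i =>
          (ContinuousLinearMap.id ℝ _ - (innerSL ℝ (p'.1 i).1).smulRight (p'.1 i).1).comp
          ((ContinuousLinearMap.proj i).comp (ContinuousLinearMap.fst ℝ _ _)))
        (ContinuousLinearMap.pi fun j =>
          (ContinuousLinearMap.id ℝ _ - (innerSL ℝ (p'.2 j).1).smulRight (p'.2 j).1).comp
          ((ContinuousLinearMap.proj j).comp (ContinuousLinearMap.snd ℝ _ _)))) (incl p') := by
    refine HasFDerivAt.prodMk (hasFDerivAt_pi.2 fun i => ?_) (hasFDerivAt_pi.2 fun j => ?_)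
    · exact HasFDerivAt.comp (f := fun v : Ambient m n => v.1 i) (incl p')
        (hasFDerivAt_inv_norm_smul (norm_eq_of_mem_sphere (p'.1 i)))
        (ContinuousLinearMap.hasFDerivAt (f := (ContinuousLinearMap.proj i).comp
          (ContinuousLinearMap.fst ℝ (∀ i, EuclideanSpace ℝ (Fin (m i + 1)))
            (∀ j, EuclideanSpace ℝ (Fin (n j + 1))))))
    · exact HasFDerivAt.comp (f := fun v : Ambient m n => v.2 j) (incl p')
        (hasFDerivAt_inv_norm_smul (norm_eq_of_mem_sphere (p'.2 j)))
        (ContinuousLinearMap.hasFDerivAt (f := (ContinuousLinearMap.proj j).comp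
          (ContinuousLinearMap.snd ℝ (∀ i, EuclideanSpace ℝ (Fin (m i + 1)))
            (∀ j, EuclideanSpace ℝ (Fin (n j + 1))))))
  have d2 := (d1.congr_of_eventuallyEq h2).hasMFDerivAt.mfderiv
  have h3 : MDifferentiableAt (PS.model m n) 𝓘(ℝ, Ambient m n) S (retr (incl p')) := by
    rw [retr_incl]; exact h1.mdifferentiableAt (by simp)
  have d3 := mfderiv_comp (incl p') h3 ((contMDiffAt_retr p').mdifferentiableAt (by simp))
  rw [show (S ∘ retr) = fun v => S (retr v) from rfl, d2] at d3
  have d4 := congrArg (fun L : Ambient m n →L[ℝ] Ambient m n => L w) d3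
  have d5 : dSec S (PS.mk' m n p') (dRetr p' w) = dSec S (retr (incl p')) (dRetr p' w) := by
    rw [retr_incl]
  rw [d5]
  have d6 : dSec S (retr (incl p')) (dRetr p' w) =
    (fun i => w.1 i - (inner ℝ (p'.1 i).1 (w.1 i) : ℝ) • (p'.1 i).1,
      fun j => w.2 j - (inner ℝ (p'.2 j).1 (w.2 j) : ℝ) • (p'.2 j).1) := d4.symm
  rw [d6]
  refine Prod.ext (funext fun i => ?_) (funext fun j => ?_)
  · simp [radialInv, radial]
  · simp [radialInv, radial]

/-- The linear isomorphism from the ambient Euclidean space to the fibre of `T P_S ⊕ (k + ℓ) ε`. -/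
def tangentEquiv (p : SphProd m × SphProd n) :
    Ambient m n ≃ₗ[ℝ] PS.E m n × (Fin (k + l) → ℝ) :=
  LinearMap.linearEquivOfInjective ((dRetr p).toLinearMap.prod (radial p)) (by
    -- The left inverse built from `S` gives injectivity; the equality of dimensions does the rest.
    obtain ⟨S, hS, hS'⟩ := exists_section p
    have h := (eventually_dSec_dRetr hS hS').self_of_nhds
    intro v w hvw
    rw [← h v, ← h w]
    have h1 : dRetr p v = dRetr p w := congrArg Prod.fst hvw
    have h2 : radial p v = radial p w := congrArg Prod.snd hvw
    rw [h1, h2]) finrank_ambient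

theorem tangentEquiv_apply (p : SphProd m × SphProd n) (w : Ambient m n) :
    tangentEquiv p w = (dRetr p w, radial p w) := rfl

theorem tangentEquiv_smul (g : ℤˣ × (Fin l → ℤˣ)) (p : SphProd m × SphProd n)
    (w : Ambient m n) : tangentEquiv (g • p) (ambientAct g w) = tangentEquiv p w := by
  simp only [tangentEquiv_apply, dRetr_smul, radial_smul]

variable (m n) in
/-- The frame of `T P_S ⊕ (k + ℓ) ε` given by the derivative of `PS.retr` and by the inner products
with the position vectors. -/
def tangentFrame : ((PS.tangent m n).sum (VectorFamily.trivial (PS m n) (k + l))).Frame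
    (PS.mk' m n) (Ambient m n) where
  continuous_proj :=
    Continuous.comp (g := (TotalSpace.proj : TangentBundle (PS.model m n) (PS m n) → PS m n))
      (FiberBundle.continuous_proj (PS.E m n) (TangentSpace (PS.model m n) : PS m n → Type _))
      (continuous_fst.comp (VectorFamily.continuous_sumSplit (PS.tangent m n)
        (VectorFamily.trivial (PS m n) (k + l))))
  toEquiv p _ := tangentEquiv p
  continuous_toEquiv := by
    refine continuous_induced_rng.2 (Continuous.prodMk ?_ ?_)
    · have h : Continuous (fun p : (SphProd m × SphProd n) × Ambient m n =>
          (⟨retr (incl p.1), dRetr p.1 p.2⟩ : TangentBundle (PS.model m n) (PS m n))) := by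
        refine continuous_iff_continuousAt.2 fun ⟨p, w⟩ => ?_
        exact ContinuousAt.comp (f := fun p : (SphProd m × SphProd n) × Ambient m n =>
            (incl p.1, p.2)) (x := (p, w))
          (ContMDiffAt.continuousAt_tangentMap_model ((contMDiffAt_retr p).of_le (by simp)))
          ((continuous_incl.prodMap continuous_id).continuousAt)
      refine h.congr fun ⟨p, w⟩ => ?_
      -- `retr (incl p)` and `PS.mk' m n p` are only propositionally equal, so the base point is
      -- generalized.
      have key : ∀ b, b = PS.mk' m n p → (⟨b, dRetr p w⟩ :
          TangentBundle (PS.model m n) (PS m n)) = ⟨PS.mk' m n p, dRetr p w⟩ := by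
        rintro _ rfl; rfl
      exact key _ (retr_incl p)
    · refine (Bundle.Trivial.isInducing_toProd (PS m n) (Fin (k + l) → ℝ)).continuous_iff.2 ?_
      exact ((PS.isQuotientCoveringMap_mk' m n).continuous.comp continuous_fst).prodMk
        continuous_radial
  continuous_symm := by
    have hi := VectorFamily.continuous_sumSplit (PS.tangent m n)
      (VectorFamily.trivial (PS m n) (k + l))
    have ht : Continuous (fun p : TotalSpace (VectorFamily.trivial (PS m n) (k + l)).F
        (VectorFamily.trivial (PS m n) (k + l)).Fib => (p.2 : Fin (k + l) → ℝ)) :=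
      Continuous.comp (g := Prod.snd) continuous_snd
        (Bundle.Trivial.isInducing_toProd (PS m n) (Fin (k + l) → ℝ)).continuous
    let D := {p : (SphProd m × SphProd n) × TotalSpace (PS.tangent m n |>.sum
        (VectorFamily.trivial (PS m n) (k + l))).F (PS.tangent m n |>.sum
        (VectorFamily.trivial (PS m n) (k + l))).Fib // PS.mk' m n p.1 = p.2.proj}
    refine continuous_iff_continuousAt.2 fun q₀ => ?_
    obtain ⟨⟨p₀, b₀, v₀, t₀⟩, hb₀⟩ := q₀
    change PS.mk' m n p₀ = b₀ at hb₀
    subst hb₀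
    -- Near `p₀` the inverse is $(v,t)\mapsto dS(v)+$ `radialInv p t`, visibly continuous; the final
    -- lines check this on vectors written as `tangentEquiv p w`.
    obtain ⟨S, hS, hS'⟩ := exists_section p₀
    have hv : Continuous (fun q : D => (⟨q.1.2.1, q.1.2.2.1⟩ :
        TangentBundle (PS.model m n) (PS m n))) :=
      continuous_fst.comp (hi.comp (continuous_snd.comp continuous_subtype_val))
    have htt : Continuous (fun q : D => ((q.1.1, q.1.2.2.2) :
        (SphProd m × SphProd n) × (Fin (k + l) → ℝ))) :=
      (continuous_fst.comp continuous_subtype_val).prodMk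
        (ht.comp (continuous_snd.comp (hi.comp (continuous_snd.comp continuous_subtype_val))))
    have h1 : ContinuousAt (fun q : D => (dSec S q.1.2.1 q.1.2.2.1 : Ambient m n))
        ⟨(p₀, ⟨PS.mk' m n p₀, (v₀, t₀)⟩), rfl⟩ :=
      ContinuousAt.comp
        (g := fun q : TangentBundle (PS.model m n) (PS m n) => (dSec S q.1 q.2 : Ambient m n))
        (f := fun q : D => (⟨q.1.2.1, q.1.2.2.1⟩ : TangentBundle (PS.model m n) (PS m n)))
        (x := (⟨(p₀, ⟨PS.mk' m n p₀, (v₀, t₀)⟩), rfl⟩ : D))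
        (ContMDiffAt.continuousAt_mfderiv_apply
          (p := (⟨PS.mk' m n p₀, v₀⟩ : TangentBundle (PS.model m n) (PS m n)))
          (hS.of_le (by simp))) hv.continuousAt
    have h2 := h1.add (continuous_radialInv.comp htt).continuousAt
    refine h2.congr ?_
    have hp : Continuous (fun q : D => q.1.1) := continuous_fst.comp continuous_subtype_val
    have h3 := (hp.tendsto ⟨(p₀, ⟨PS.mk' m n p₀, (v₀, t₀)⟩), rfl⟩).eventually
      (eventually_dSec_dRetr hS hS')
    filter_upwards [h3] with ⟨⟨p, b, a⟩, hb⟩ hq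
    change PS.mk' m n p = b at hb
    subst hb
    obtain ⟨w, rfl⟩ := (tangentEquiv p).surjective a
    exact (hq w).trans ((tangentEquiv p).symm_apply_apply w).symm

theorem tangentFrame_equivariant :
    (tangentFrame m n).Equivariant (fun g : ℤˣ × (Fin l → ℤˣ) => ambientAct g) :=
  fun g p _ w => tangentEquiv_smul g p w

/-! ### The frame of the sum of line bundles -/

variable (m) in
/-- The coordinates of a tuple of vectors, listed in one row. -/
def flatten : (∀ i, EuclideanSpace ℝ (Fin (m i + 1))) ≃L[ℝ] (Fin (∑ i, (m i + 1)) → ℝ) where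
  toFun v a := v (finSigmaFinEquiv.symm a).1 (finSigmaFinEquiv.symm a).2
  invFun t i := WithLp.toLp 2 fun c => t (finSigmaFinEquiv ⟨i, c⟩)
  left_inv v := by
    funext i
    ext c
    exact congrArg (fun s : (i : Fin k) × Fin (m i + 1) => v s.1 s.2)
      (finSigmaFinEquiv.symm_apply_apply ⟨i, c⟩)
  right_inv t := by
    funext a
    simp
  map_add' _ _ := rfl
  map_smul' _ _ := rfl
  continuous_toFun := by fun_prop
  continuous_invFun := by fun_prop

variable (m n) in
/-- The coordinates of a vector of the ambient Euclidean space. -/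
def ambientCoords : Ambient m n ≃L[ℝ]
    (Fin (∑ i, (m i + 1)) → ℝ) × (∀ j, Fin (n j + 1) → ℝ) :=
  (flatten m).prodCongr
    (ContinuousLinearEquiv.piCongrRight fun j => EuclideanSpace.equiv (Fin (n j + 1)) ℝ)

variable (m n) in
/-- The frame of `η` over `S(m) × ∏ S^{n_j}`. -/
def etaFrame : (PS.eta m n).Frame (PS.mk' m n) ℝ :=
  (LineFib.frame (PS.isQuotientCoveringMap_mk m n) (MonoidHom.id ℤˣ)).pullback
    (fun p : SphProd m × SphProd n => ((p.1, fun j => RP.mk (p.2 j)) : SphProd m × RPProd n))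
    (continuous_fst.prodMk (continuous_pi fun j =>
      continuous_quotient_mk'.comp ((continuous_apply j).comp continuous_snd)))

variable (m n) in
/-- The frame of the sum of line bundles given by the coordinates of the ambient Euclidean space. -/
def lineSumFrame :
    (VectorFamily.sum (VectorFamily.copies (∑ i : Fin k, (m i + 1)) (PS.eta m n))
      (VectorFamily.iSum fun j : Fin l =>
        VectorFamily.copies (n j + 1) (PS.zeta m n j))).Frame (PS.mk' m n) (Ambient m n) :=
  (((etaFrame m n).copies _ (PS.isQuotientCoveringMap_mk' m n).continuous).sum
    (VectorFamily.Frame.iSum (fun j =>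
      VectorFamily.Frame.copies (n j + 1)
        (LineFib.frame (PS.isQuotientCoveringMap_mk' m n) (PS.zetaChar j) :
          (PS.zeta m n j).Frame (PS.mk' m n) ℝ)
        (PS.isQuotientCoveringMap_mk' m n).continuous)
      (PS.isQuotientCoveringMap_mk' m n).continuous)).congr (ambientCoords m n)

/-- The sign changes `g.2`, and in fact all of $\mathbb Z_2\times\mathbb Z_2^\ell$, are invisible on
the projective factors, so the group acts on $S(m)\times\prod\mathbb RP^{n_j}$ through `g.1` alone.
-/
theorem etaFrame_smul (g : ℤˣ × (Fin l → ℤˣ)) (p : SphProd m × SphProd n) {b : PS m n}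
    (h : PS.mk' m n p = b) (h' : PS.mk' m n (g • p) = b) (t : ℝ) :
    (etaFrame m n).toEquiv (g • p) h' (sgn g.1 * t) = (etaFrame m n).toEquiv p h t := by
  have hp : (((g • p).1, fun j => RP.mk ((g • p).2 j)) : SphProd m × RPProd n) =
      g.1 • (p.1, fun j => RP.mk (p.2 j)) := by
    refine Prod.ext rfl (funext fun j => ?_)
    change RP.mk ((g.1 * g.2 j) • p.2 j) = g.1 • RP.mk (p.2 j)
    rw [RP.smul_eq, RP.mk_smul]
  have key : ∀ (y : SphProd m × RPProd n) (hy : PS.mk m n y = b),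
      y = g.1 • (p.1, fun j => RP.mk (p.2 j)) →
      (LineFib.frame (PS.isQuotientCoveringMap_mk m n) (MonoidHom.id ℤˣ)).toEquiv y hy
        (sgn g.1 * t) = (etaFrame m n).toEquiv p h t := by
    rintro _ hy rfl
    exact LineFib.frame_toEquiv_smul (PS.isQuotientCoveringMap_mk m n) (MonoidHom.id ℤˣ) g.1 _ h hy t
  exact key _ h' hp

/-- Checked one coordinate at a time: the signs in `ambientAct` are the characters of the
corresponding line bundles. -/
theorem lineSumFrame_equivariant :
    (lineSumFrame m n).Equivariant (fun g : ℤˣ × (Fin l → ℤˣ) => ambientAct g) := by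
  intro g p h w
  refine Prod.ext (funext fun a => ?_) (funext fun j => funext fun c => ?_)
  · exact etaFrame_smul g p h rfl _
  · exact LineFib.frame_toEquiv_smul (PS.isQuotientCoveringMap_mk' m n) (PS.zetaChar j) g p h rfl _

end PS

end

/-- `η` and the `ζ'_j` are line bundles on `P_S(m; n)`, and
`T(P_S(m; n)) ⊕ (k + ℓ) ε ≅ (∑ i, (m_i + 1)) η ⊕ (n_1 + 1) ζ'_1 ⊕ ⋯ ⊕ (n_ℓ + 1) ζ'_ℓ`. -/
theorem mainTheorem7 (k l : ℕ) [NeZero k] (m : Fin k → ℕ) (n : Fin l → ℕ) :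
    (PS.eta m n).IsLineBundle ∧
    (∀ j : Fin l, (PS.zeta m n j).IsLineBundle) ∧
    VectorFamily.Isomorphic
      (VectorFamily.sum (PS.tangent m n) (VectorFamily.trivial (PS m n) (k + l)))
      (VectorFamily.sum (VectorFamily.copies (∑ i : Fin k, (m i + 1)) (PS.eta m n))
        (VectorFamily.iSum fun j : Fin l =>
          VectorFamily.copies (n j + 1) (PS.zeta m n j))) := by
  refine ⟨?_, fun j => ?_, ?_⟩
  · exact (LineFib.frame (PS.isQuotientCoveringMap_mk m n) (MonoidHom.id ℤˣ)).isLineBundle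
      (PS.isQuotientCoveringMap_mk m n).isCoveringMap.isLocalHomeomorph
      (PS.isQuotientCoveringMap_mk m n).surjective
  · exact (LineFib.frame (PS.isQuotientCoveringMap_mk' m n) (PS.zetaChar j)).isLineBundle
      (PS.isQuotientCoveringMap_mk' m n).isCoveringMap.isLocalHomeomorph
      (PS.isQuotientCoveringMap_mk' m n).surjective
  · exact PS.tangentFrame_equivariant.isomorphic PS.lineSumFrame_equivariant
      (PS.isQuotientCoveringMap_mk' m n)
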